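/- Let $n\ge 1$. A convex body in $\mathbb R^n$ is a compact convex set with non-empty interior; a lattice $\Lambda\subset\mathbb R^n$ is a set $\Lambda=B\mathbb Z^n$ with $B\in\mathbb R^{n\times n}$ invertible, and $\det(\Lambda)=|\det B|$. For a convex body $K$, a lattice $\Lambda$ and $1\le i\le n$, the $i$th packing minimum is $$\rho_i(K,\Lambda)=\inf\{\rho>0 : (\rho(K-K)+L)\cap\Lambda\neq L\cap\Lambda\ \text{ for every linear subspace } L\subseteq\mathbb R^n \text{ with } \dim L=n-i\}.$$ **Theorem.** For every convex body $K\subset\mathbb R^n$ and every lattice $\Lambda\subset\mathbb R^n$, $$\frac1{n!}\prod_{i=1}^n\frac1{\rho_i(K,\Lambda)}\ \le\ \frac{\operatorname{vol}(K)}{\det(\Lambda)}\ \le\ \prod_{i=1}^n\frac1{\rho_i(K,\Lambda)}.$$ Both bounds are sharp: for all $0<r_1\le\dots\le r_n$, with $\Lambda=\mathbb Z^n$, the convex body $K=C(r)=[-r_1,r_1]\times\dots\times[-r_n,r_n]$ attains equality in the upper bound, and its polar $K=C(r)^\star=\{y\in\mathbb R^n : \langle x,y\rangle\le 1 \text{ for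 all } x\in C(r)\}$ (also a convex body) attains equality in the lower bound. -/

import Mathlib

open MeasureTheory Module
open scoped Pointwise Nat

/-- A convex body in `ℝⁿ`: a compact convex set with non-empty interior. -/
structure IsConvexBody {n : ℕ} (K : Set (EuclideanSpace ℝ (Fin n))) : Prop where
  convex : Convex ℝ K
  isCompact : IsCompact K
  nonempty_interior : (interior K).Nonempty

/-- The `i`-th packing minimum `ρᵢ(K, Λ)`, for `1 ≤ i ≤ n`: the infimum of all `ρ > 0` such that
`(ρ (K - K) + L) ∩ Λ ≠ L ∩ Λ` for every linear subspace `L` of `ℝⁿ` of dimension `n - i`. -/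
noncomputable def packingMin {n : ℕ} (K : Set (EuclideanSpace ℝ (Fin n)))
    (Λ : Submodule ℤ (EuclideanSpace ℝ (Fin n))) (i : ℕ) : ℝ :=
  sInf {ρ : ℝ | 0 < ρ ∧ ∀ L : Submodule ℝ (EuclideanSpace ℝ (Fin n)), finrank ℝ L + i = n →
    (ρ • (K - K) + (L : Set (EuclideanSpace ℝ (Fin n)))) ∩ (Λ : Set (EuclideanSpace ℝ (Fin n))) ≠
      (L : Set (EuclideanSpace ℝ (Fin n))) ∩ (Λ : Set (EuclideanSpace ℝ (Fin n)))}

/-- The standard lattice `ℤⁿ` in `ℝⁿ`. -/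
noncomputable def stdLattice (n : ℕ) : Submodule ℤ (EuclideanSpace ℝ (Fin n)) :=
  Submodule.span ℤ (Set.range (EuclideanSpace.basisFun (Fin n) ℝ))

/-- The box `C(r) = [-r₁, r₁] × ⋯ × [-rₙ, rₙ]`. -/
def box {n : ℕ} (r : Fin n → ℝ) : Set (EuclideanSpace ℝ (Fin n)) :=
  {x | ∀ j, x j ∈ Set.Icc (-r j) (r j)}

/-- The polar `{y | ⟪x, y⟫ ≤ 1 for all x ∈ K}` of a set `K`. -/
def polarBody {n : ℕ} (K : Set (EuclideanSpace ℝ (Fin n))) : Set (EuclideanSpace ℝ (Fin n)) :=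
  {y | ∀ x ∈ K, inner ℝ x y ≤ 1}

/-! Both bounds come from greedily built lattice bases b_0, …, b_{n-1}. With L_i the span of the
first i vectors, a subspace of dimension i tests the packing minimum ρ_{n-i}.

Lower bound: let μ_i be the least factor for which μ_i(K - K) + L_i contains a lattice point outside
L_i, and let b_i be such a point. Testing L_i alone gives μ_i ≤ ρ_{n-i}. In the coordinates of the
b_i, K contains segments forming a triangular system with diagonal 1/μ_i, and
`ofReal_prod_div_factorial_le_volume` turns these into the volume bound.

Upper bound: let s_i be the least factor for which s_i(K - K) itself contains a lattice point v_i
outside L_i, and choose b_i in L_i + ℝv_i. A subspace of dimension i misses one of v_0, …, v_i, so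
ρ_{n-i} ≤ s_i. Minkowski's second theorem, `ofReal_prod_mul_volume_le_one`, bounds the product of
the s_i.

In both cases `IsAdapted.exists_insert` makes the b_i a lattice basis. For sharpness, coordinate
subspaces bound the minima of the box from below, and unit vectors bound those of its polar from
above. -/

/-! ### Volume of a convex body containing a triangular system of segments -/

/-- The points of `P`, contracted towards `p₀` by a factor `1 - u`, together with the parameter `u`. -/
def contractionGraph {n : ℕ} (P : Set (Fin n → ℝ)) (p₀ : Fin n → ℝ) : Set (ℝ × (Fin n → ℝ)) :=
  (fun q : ℝ × (Fin n → ℝ) => (q.1, q.1 • p₀ + (1 - q.1) • q.2)) '' (Set.Icc 0 1 ×ˢ P)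

/-- The slice at u is a translate of (1 - u)P, and (1 - u)^n integrates to 1/(n + 1) over [0, 1]. -/
theorem volume_contractionGraph {n : ℕ} {P : Set (Fin n → ℝ)} (hP : IsCompact P)
    (p₀ : Fin n → ℝ) :
    volume (contractionGraph P p₀) = ENNReal.ofReal (1 / (n + 1)) * volume P := by
  have hcomp : IsCompact (contractionGraph P p₀) :=
    (isCompact_Icc.prod hP).image (by fun_prop)
  rw [Measure.volume_eq_prod, Measure.prod_apply hcomp.measurableSet]
  have hfib : ∀ u : ℝ, volume (Prod.mk u ⁻¹' contractionGraph P p₀) =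
      (Set.Icc (0 : ℝ) 1).indicator (fun u => ENNReal.ofReal ((1 - u) ^ n) * volume P) u := by
    intro u
    by_cases hu : u ∈ Set.Icc (0 : ℝ) 1
    · rw [Set.indicator_of_mem hu]
      have : Prod.mk u ⁻¹' contractionGraph P p₀ =
          (fun x => u • p₀ + x) '' ((1 - u) • P) := by
        ext x
        simp only [contractionGraph, Set.mem_preimage, Set.mem_image, Set.mem_prod, Prod.mk.injEq,
          Prod.exists, Set.mem_smul_set]
        constructor
        · rintro ⟨a, q, ⟨_, hq⟩, rfl, rfl⟩
          exact ⟨_, ⟨q, hq, rfl⟩, rfl⟩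
        · rintro ⟨_, ⟨q, hq, rfl⟩, rfl⟩
          exact ⟨u, q, ⟨hu, hq⟩, rfl, rfl⟩
      rw [this, Set.image_add_left, measure_preimage_add,
        Measure.addHaar_smul_of_nonneg _ (by linarith [hu.2])]
      simp
    · rw [Set.indicator_of_notMem hu]
      have : Prod.mk u ⁻¹' contractionGraph P p₀ = ∅ := by
        ext x
        simp only [contractionGraph, Set.mem_preimage, Set.mem_image, Set.mem_prod, Prod.mk.injEq,
          Prod.exists, Set.mem_empty_iff_false, iff_false]
        rintro ⟨a, q, ⟨ha, _⟩, rfl, _⟩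
        exact hu ha
      rw [this, measure_empty]
  simp_rw [hfib]
  rw [lintegral_indicator measurableSet_Icc, lintegral_mul_const _ (by fun_prop)]
  congr 1
  rw [← ofReal_integral_eq_lintegral_ofReal]
  · congr 1
    rw [integral_Icc_eq_integral_Ioc, ← intervalIntegral.integral_of_le zero_le_one,
      intervalIntegral.integral_comp_sub_left (fun x => x ^ n) 1]
    simp
  · exact (Continuous.integrableOn_Icc (by fun_prop))
  · filter_upwards [ae_restrict_mem measurableSet_Icc] with u hu
    exact pow_nonneg (by linarith [hu.2]) _

theorem ofReal_le_volume_fiber {n : ℕ} {K : Set (Fin (n + 1) → ℝ)} (hK : Convex ℝ K)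
    {p : Fin n → ℝ} {s t : ℝ} (hs : Fin.cons s p ∈ K) (ht : Fin.cons t p ∈ K) :
    ENNReal.ofReal (t - s) ≤ volume {a : ℝ | (Fin.cons a p : Fin (n + 1) → ℝ) ∈ K} := by
  rw [← Real.volume_Icc]
  refine measure_mono fun a ha => ?_
  have hconv : Convex ℝ {a : ℝ | (Fin.cons a p : Fin (n + 1) → ℝ) ∈ K} := by
    intro a ha b hb u v hu hv huv
    have := hK ha hb hu hv huv
    simp only [Set.mem_ofPred_eq] at *
    convert this using 1
    ext j
    refine Fin.cases ?_ (fun j => ?_) j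
    · simp
    · simp [← add_mul, huv]
  exact hconv.ordConnected.out hs ht ha

/-- For k in K, the points ux + (1 - u)k and uy + (1 - u)k lie in K over the same base point, at
distance u(y 0 - x 0). So the fibre over p is at least y 0 - x 0 times as long as the set of u with
(u, p) in the contraction graph; integrating over p gives the factor 1/(n + 1). -/
theorem ofReal_mul_volume_tail_le {n : ℕ} {K : Set (Fin (n + 1) → ℝ)} (hK : Convex ℝ K)
    (hc : IsCompact K) {x y : Fin (n + 1) → ℝ} (hx : x ∈ K) (hy : y ∈ K)
    (hxy : Fin.tail y = Fin.tail x) :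
    ENNReal.ofReal ((y 0 - x 0) / (n + 1)) * volume (Fin.tail '' K) ≤ volume K := by
  rcases le_or_gt (y 0 - x 0) 0 with h0 | h0
  · rw [ENNReal.ofReal_of_nonpos (div_nonpos_of_nonpos_of_nonneg h0 (by positivity)), zero_mul]
    exact zero_le
  have htail : Continuous (Fin.tail : (Fin (n + 1) → ℝ) → Fin n → ℝ) := by
    unfold Fin.tail; fun_prop
  set P := Fin.tail '' K
  have hP : IsCompact P := hc.image htail
  have hmp := volume_preserving_piFinSuccAbove (fun _ : Fin (n + 1) => ℝ) 0
  have hvol : volume K = ∫⁻ p : Fin n → ℝ, volume {a : ℝ | (Fin.cons a p : Fin (n + 1) → ℝ) ∈ K} := by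
    have e := hmp.symm.measure_preimage_equiv K
    rw [← e, Measure.volume_eq_prod, Measure.prod_apply_symm]
    · refine lintegral_congr fun p => ?_
      congr 1
      ext a
      simp [MeasurableEquiv.piFinSuccAbove, Fin.consEquiv]
    · exact (MeasurableEquiv.measurable _) hc.measurableSet
  have hcg : MeasurableSet (contractionGraph P (Fin.tail x)) :=
    ((isCompact_Icc.prod hP).image (by fun_prop)).measurableSet
  rw [hvol, div_eq_mul_one_div, ENNReal.ofReal_mul h0.le, mul_assoc,
    ← volume_contractionGraph hP (Fin.tail x), Measure.volume_eq_prod,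
    Measure.prod_apply_symm hcg, ← lintegral_const_mul _ (measurable_measure_prodMk_right hcg)]
  refine lintegral_mono fun p => ?_
  set ℓ := volume {a : ℝ | (Fin.cons a p : Fin (n + 1) → ℝ) ∈ K} with hℓ
  have key : ∀ u : ℝ, (u, p) ∈ contractionGraph P (Fin.tail x) →
      0 ≤ u ∧ ENNReal.ofReal (u * (y 0 - x 0)) ≤ ℓ := by
    rintro u ⟨⟨u', q⟩, ⟨hu, ⟨k, hk, rfl⟩⟩, hpq⟩
    simp only [Prod.mk.injEq] at hpq
    obtain ⟨rfl, rfl⟩ := hpq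
    have h1 := hK hx hk hu.1 (sub_nonneg.2 hu.2) (by ring)
    have h2 := hK hy hk hu.1 (sub_nonneg.2 hu.2) (by ring)
    refine ⟨hu.1, ?_⟩
    have := ofReal_le_volume_fiber (p := u' • Fin.tail x + (1 - u') • Fin.tail k)
      (s := u' * x 0 + (1 - u') * k 0) (t := u' * y 0 + (1 - u') * k 0) hK
      (by convert h1 using 1; ext j; refine Fin.cases ?_ (fun j => ?_) j <;> simp [Fin.tail])
      (by
        rw [← hxy]
        convert h2 using 1; ext j; refine Fin.cases ?_ (fun j => ?_) j <;> simp [Fin.tail])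
    convert this using 2
    ring
  rcases eq_or_ne ℓ ⊤ with htop | htop
  · rw [htop]; exact le_top
  calc ENNReal.ofReal (y 0 - x 0) * volume ((fun u => (u, p)) ⁻¹' contractionGraph P (Fin.tail x))
      ≤ ENNReal.ofReal (y 0 - x 0) * volume (Set.Icc 0 (ℓ.toReal / (y 0 - x 0))) := by
        gcongr
        intro u hu
        obtain ⟨h1, h2⟩ := key u hu
        refine ⟨h1, ?_⟩
        rw [le_div_iff₀ h0]
        exact (ENNReal.ofReal_le_iff_le_toReal htop).1 h2
    _ = ℓ := by
        rw [Real.volume_Icc, ← ENNReal.ofReal_mul h0.le, sub_zero, mul_div_cancel₀ _ h0.ne',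
          ENNReal.ofReal_toReal htop]

/-- A compact convex set that contains, for each `i`, a segment whose direction has `i`th
coordinate `d i` and vanishing later coordinates, has volume at least `(∏ d i) / n!`. -/
theorem ofReal_prod_div_factorial_le_volume {n : ℕ} {K : Set (Fin n → ℝ)} (hK : Convex ℝ K)
    (hc : IsCompact K) (hne : K.Nonempty) {d : Fin n → ℝ} (hd : ∀ i, 0 ≤ d i)
    (h : ∀ i, ∃ x ∈ K, ∃ y ∈ K, y i - x i = d i ∧ ∀ j, i < j → y j = x j) :
    ENNReal.ofReal ((∏ i, d i) / n !) ≤ volume K := by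
  induction n with
  | zero =>
    have : K = Set.univ := Subsingleton.eq_univ_of_nonempty hne
    simp [this, volume_pi]
  | succ n ih =>
    have htail : Continuous (Fin.tail : (Fin (n + 1) → ℝ) → Fin n → ℝ) := by
      unfold Fin.tail; fun_prop
    have hPconv : Convex ℝ (Fin.tail '' K) := by
      rintro _ ⟨a, ha, rfl⟩ _ ⟨b, hb, rfl⟩ u v hu hv huv
      exact ⟨_, hK ha hb hu hv huv, rfl⟩
    -- The segment of index 0 is parallel to the axis being projected away; the others project to a
    -- triangular system one dimension lower.
    have hP := ih hPconv (hc.image htail) (hne.image _) (d := fun i => d i.succ)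
      (fun i => hd _) (fun i => by
        obtain ⟨x, hx, y, hy, h1, h2⟩ := h i.succ
        exact ⟨_, ⟨x, hx, rfl⟩, _, ⟨y, hy, rfl⟩, h1, fun j hj => h2 _ (Fin.succ_lt_succ_iff.2 hj)⟩)
    obtain ⟨x, hx, y, hy, h1, h2⟩ := h 0
    refine le_trans ?_ (ofReal_mul_volume_tail_le hK hc hx hy
      (funext fun j => h2 j.succ (Fin.succ_pos j)))
    refine le_trans ?_ (mul_le_mul_right hP _)
    rw [h1, ← ENNReal.ofReal_mul (div_nonneg (hd 0) (by positivity)), Fin.prod_univ_succ,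
      Nat.factorial_succ]
    refine ENNReal.ofReal_le_ofReal (le_of_eq ?_)
    push_cast
    field_simp

/-! ### Folding modulo integer translations and Minkowski's second theorem -/

/-- The integer vectors supported on the coordinates that satisfy `p`. -/
def partialLattice {ι : Type*} (p : ι → Prop) : Set (ι → ℝ) :=
  {z | ∃ m : ι → ℤ, (∀ j, ¬ p j → m j = 0) ∧ z = fun j => (m j : ℝ)}

/-- The product of `[0, 1)` in the coordinates that satisfy `p` and `ℝ` in the others. -/
def slab {ι : Type*} (p : ι → Prop) : Set (ι → ℝ) :=
  {x | ∀ j, p j → x j ∈ Set.Ico (0 : ℝ) 1}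

/-- The volume of a set modulo the integer translations in the coordinates that satisfy `p`. -/
noncomputable def foldVolume {ι : Type*} [Fintype ι] (p : ι → Prop) (A : Set (ι → ℝ)) : ENNReal :=
  volume ((A + partialLattice p) ∩ slab p)

theorem measurableSet_slab {ι : Type*} [Countable ι] (p : ι → Prop) : MeasurableSet (slab p) := by
  have : slab p = ⋂ j, ⋂ _ : p j, (fun x : ι → ℝ => x j) ⁻¹' Set.Ico 0 1 := by
    ext x; simp [slab]
  rw [this]
  exact .iInter fun j => .iInter fun _ => measurable_pi_apply j measurableSet_Ico

theorem foldVolume_false {ι : Type*} [Fintype ι] (A : Set (ι → ℝ)) :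
    foldVolume (fun _ => False) A = volume A := by
  have h1 : (partialLattice fun _ : ι => False) = {0} := by
    ext z
    simp only [partialLattice, not_false_eq_true, forall_const, Set.mem_ofPred_eq,
      Set.mem_singleton_iff]
    constructor
    · rintro ⟨m, hm, rfl⟩; ext j; simp [hm j]
    · rintro rfl; exact ⟨0, by simp, by ext; simp⟩
  have h2 : (slab fun _ : ι => False) = Set.univ := by ext; simp [slab]
  rw [foldVolume, h1, h2]
  simp

theorem foldVolume_true_le_one {ι : Type*} [Fintype ι] (A : Set (ι → ℝ)) :
    foldVolume (fun _ => True) A ≤ 1 := by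
  refine (measure_mono Set.inter_subset_right).trans ?_
  have : (slab fun _ : ι => True) = Set.univ.pi fun _ => Set.Ico (0 : ℝ) 1 := by
    ext; simp [slab]
  rw [this, Real.volume_pi_Ico]
  simp

theorem foldVolume_mono {ι : Type*} [Fintype ι] {p : ι → Prop} {A B : Set (ι → ℝ)} (h : A ⊆ B) :
    foldVolume p A ≤ foldVolume p B :=
  measure_mono (Set.inter_subset_inter_left _ (Set.add_subset_add_right h))

theorem partialLattice_true_eq {ι : Type*} [Fintype ι] :
    (partialLattice fun _ : ι => True) =
      (Submodule.span ℤ (Set.range (Pi.basisFun ℝ ι)) : Set (ι → ℝ)) := by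
  ext z
  rw [SetLike.mem_coe, Basis.mem_span_iff_repr_mem]
  simp only [partialLattice, not_true_eq_false, false_implies, implies_true, true_and,
    Set.mem_ofPred_eq, Pi.basisFun_repr, algebraMap_int_eq, Set.mem_range, eq_intCast]
  constructor
  · rintro ⟨m, rfl⟩ i; exact ⟨m i, rfl⟩
  · intro h; choose m hm using h; exact ⟨m, funext fun i => (hm i).symm⟩

theorem slab_true_eq {ι : Type*} [Fintype ι] :
    (slab fun _ : ι => True) = ZSpan.fundamentalDomain (Pi.basisFun ℝ ι) := by
  ext z; simp [slab, ZSpan.mem_fundamentalDomain]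

/-- Translating U amounts to translating the fundamental domain the other way, and the
lattice-periodic set U + Λ has the same volume in every fundamental domain. -/
theorem foldVolume_true_translate {ι : Type*} [Fintype ι] {U : Set (ι → ℝ)} (hU : IsOpen U)
    (τ : ι → ℝ) : foldVolume (fun _ => True) (τ +ᵥ U) = foldVolume (fun _ => True) U := by
  unfold foldVolume
  rw [slab_true_eq, partialLattice_true_eq]
  set b := Pi.basisFun ℝ ι
  set Λ := Submodule.span ℤ (Set.range b)
  have hF := ZSpan.isAddFundamentalDomain b (volume : Measure (ι → ℝ))
  have hF' := hF.vadd_of_comm (-τ)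
  have h1 : ((τ +ᵥ U) + (Λ : Set (ι → ℝ))) ∩ ZSpan.fundamentalDomain b =
      τ +ᵥ ((U + (Λ : Set (ι → ℝ))) ∩ (-τ +ᵥ ZSpan.fundamentalDomain b)) := by
    rw [Set.vadd_set_inter, vadd_vadd, add_neg_cancel, zero_vadd, vadd_add_assoc]
  rw [h1, measure_vadd]
  have : VAddInvariantMeasure Λ (ι → ℝ) volume :=
    inferInstanceAs <| VAddInvariantMeasure Λ.toAddSubgroup (ι → ℝ) volume
  refine (hF.measure_set_eq hF' (hU.add_right).measurableSet fun g => ?_).symm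
  ext x
  simp only [Set.mem_preimage, Set.mem_add, SetLike.mem_coe]
  constructor
  · rintro ⟨u, hu, l, hl, h⟩
    refine ⟨u, hu, l - g, sub_mem hl g.2, ?_⟩
    rw [← add_sub_assoc, h]
    simp [Submodule.vadd_def]
  · rintro ⟨u, hu, l, hl, rfl⟩
    refine ⟨u, hu, l + g, add_mem hl g.2, ?_⟩
    simp only [Submodule.vadd_def, vadd_eq_add]
    abel

theorem foldVolume_eq_lintegral_fiber {ι : Type*} [Fintype ι] (p : ι → Prop) [DecidablePred p]
    {A : Set (ι → ℝ)} (hA : IsOpen A) :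
    foldVolume p A = ∫⁻ y : {j // ¬ p j} → ℝ, foldVolume (fun _ => True)
      {x : {j // p j} → ℝ | (Equiv.piEquivPiSubtypeProd p fun _ => ℝ).symm (x, y) ∈ A} := by
  have hmp := volume_preserving_piEquivPiSubtypeProd (fun _ : ι => ℝ) p
  have hm : MeasurableSet ((A + partialLattice p) ∩ slab p) :=
    hA.add_right.measurableSet.inter (measurableSet_slab p)
  rw [foldVolume, ← hmp.symm.measure_preimage_equiv, Measure.volume_eq_prod,
    Measure.prod_apply_symm ((MeasurableEquiv.measurable _) hm)]
  refine lintegral_congr fun y => ?_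
  rw [foldVolume]
  congr 1
  ext x
  have hval : ∀ (u : {j // p j} → ℝ) j,
      (MeasurableEquiv.piEquivPiSubtypeProd (fun _ : ι => ℝ) p).symm (u, y) j =
        if h : p j then u ⟨j, h⟩ else y ⟨j, h⟩ := fun u j => rfl
  have hval' : ∀ (u : {j // p j} → ℝ) j,
      (Equiv.piEquivPiSubtypeProd p (fun _ : ι => ℝ)).symm (u, y) j =
        if h : p j then u ⟨j, h⟩ else y ⟨j, h⟩ := fun u j => rfl
  simp only [Set.mem_preimage, Set.mem_inter_iff]
  refine and_congr ?_ ?_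
  · constructor
    · rintro ⟨a, ha, _, ⟨m, hm, rfl⟩, h⟩
      refine ⟨fun j => a j, ?_, _, ⟨fun j => m j, by simp, rfl⟩, ?_⟩
      · show _ ∈ A
        convert ha using 1
        ext j
        rw [hval']
        split_ifs with hj
        · rfl
        · have := congrFun h j
          rw [hval] at this
          simp only [Pi.add_apply, hm j hj, dif_neg hj] at this
          simpa using this.symm
      · ext j
        have := congrFun h j
        rw [hval, dif_pos j.2] at this
        exact this
    · rintro ⟨a, ha, _, ⟨m, hm, rfl⟩, rfl⟩
      refine ⟨_, ha, _, ⟨fun j => if h : p j then m ⟨j, h⟩ else 0, ?_, rfl⟩, ?_⟩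
      · intro j hj; simp [hj]
      · ext j
        rw [hval]
        show (Equiv.piEquivPiSubtypeProd p (fun _ : ι => ℝ)).symm (a, y) j +
          ((if h : p j then m ⟨j, h⟩ else 0 : ℤ) : ℝ) =
            if h : p j then a ⟨j, h⟩ + (m ⟨j, h⟩ : ℝ) else y ⟨j, h⟩
        rw [hval']
        by_cases hj : p j <;> simp [hj]
  · constructor
    · intro h j _
      have := h j.1 j.2
      rwa [hval, dif_pos j.2] at this
    · intro h j hj
      rw [hval, dif_pos hj]
      exact h ⟨j, hj⟩ trivial

theorem lintegral_comp_smul {ι : Type*} [Fintype ι] (f : (ι → ℝ) → ENNReal) {c : ℝ} (hc : 0 < c) :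
    ∫⁻ y, f y = ENNReal.ofReal (c ^ Fintype.card ι) * ∫⁻ y, f (c • y) := by
  have h := lintegral_map_equiv (μ := volume) f (MeasurableEquiv.smul₀ c hc.ne' : (ι → ℝ) ≃ᵐ (ι → ℝ))
  have h2 : Measure.map (MeasurableEquiv.smul₀ c hc.ne' : (ι → ℝ) ≃ᵐ (ι → ℝ)) volume =
      ENNReal.ofReal (|(c ^ finrank ℝ (ι → ℝ))⁻¹|) • volume := Measure.map_addHaar_smul volume hc.ne'
  rw [h2, lintegral_smul_measure] at h
  simp only [MeasurableEquiv.coe_smul₀, smul_eq_mul, finrank_fintype_fun_eq_card] at h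
  rw [← h, ← mul_assoc, ← ENNReal.ofReal_mul (by positivity), abs_of_pos (by positivity),
    mul_inv_cancel₀ (by positivity), ENNReal.ofReal_one, one_mul]

/-- If a lies in the fibre of A over y, convexity puts the translate by (c - 1)a of that fibre into
the fibre of cA over cy. Folded volume on the full torus ignores translations, so fibres do not
shrink, and substituting cy for y contributes one factor c per unfolded coordinate. -/
theorem foldVolume_smul_ge {ι : Type*} [Fintype ι] (p : ι → Prop) [DecidablePred p]
    {A : Set (ι → ℝ)} (hA : IsOpen A) (hconv : Convex ℝ A) {c : ℝ} (hc : 1 ≤ c) :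
    ENNReal.ofReal (c ^ Fintype.card {j // ¬ p j}) * foldVolume p A ≤ foldVolume p (c • A) := by
  have hc0 : 0 < c := by linarith
  rw [foldVolume_eq_lintegral_fiber p hA, foldVolume_eq_lintegral_fiber p (hA.smul₀ hc0.ne'),
    lintegral_comp_smul (fun y => foldVolume (fun _ => True)
      {x | (Equiv.piEquivPiSubtypeProd p fun _ => ℝ).symm (x, y) ∈ c • A}) hc0]
  refine mul_le_mul_right (lintegral_mono fun y => ?_) _
  set A' := {x : {j // p j} → ℝ | (Equiv.piEquivPiSubtypeProd p fun _ => ℝ).symm (x, y) ∈ A}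
  rcases A'.eq_empty_or_nonempty with h | ⟨a, ha⟩
  · rw [h]; simp [foldVolume]
  have hcont : Continuous fun x : {j // p j} → ℝ =>
      (Equiv.piEquivPiSubtypeProd p fun _ => ℝ).symm (x, y) := by
    refine continuous_pi fun j => ?_
    simp only [Equiv.piEquivPiSubtypeProd_symm_apply]
    split_ifs <;> fun_prop
  have hA' : IsOpen A' := hA.preimage hcont
  rw [← foldVolume_true_translate hA' ((c - 1) • a)]
  refine foldVolume_mono ?_
  rintro _ ⟨x, hx, rfl⟩
  rw [Set.mem_ofPred_eq, Set.mem_smul_set]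
  refine ⟨_, hconv hx ha (a := c⁻¹) (b := 1 - c⁻¹) (by positivity)
    (sub_nonneg.2 (inv_le_one_of_one_le₀ hc)) (by ring), ?_⟩
  ext j
  simp only [Pi.smul_apply, Pi.add_apply, smul_eq_mul, Equiv.piEquivPiSubtypeProd_symm_apply,
    vadd_eq_add]
  split_ifs
  · field_simp; ring
  · field_simp; ring

/-- The folded set is cut according to the integer part of coordinate k, and each piece is shifted
back to [0, 1). Under `hinj` the shifted pieces are disjoint, so folding coordinate k as well loses
no volume. -/
theorem foldVolume_le_foldVolume_insert {ι : Type*} [Fintype ι] [DecidableEq ι] {p q : ι → Prop}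
    {k : ι} (hpk : ¬ p k) (hq : ∀ j, q j ↔ p j ∨ j = k) {A : Set (ι → ℝ)} (hA : IsOpen A)
    (hinj : ∀ a ∈ A, ∀ b ∈ A, ∀ m : ι → ℤ, (∀ j, ¬ q j → m j = 0) →
      (a - b = fun j => (m j : ℝ)) → m k = 0) :
    foldVolume p A ≤ foldVolume q A := by
  set S := A + partialLattice p
  have hS : IsOpen S := hA.add_right
  set e : ℤ → ι → ℝ := fun l => Pi.single k (l : ℝ) with he
  set B : ℤ → Set (ι → ℝ) := fun l => S ∩ slab p ∩ {x | ⌊x k⌋ = l}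
  have hB : ∀ l, MeasurableSet (B l) := fun l =>
    (hS.measurableSet.inter (measurableSet_slab p)).inter
      ((Int.measurable_floor.comp (measurable_pi_apply k)) (measurableSet_singleton l))
  set T : ℤ → Set (ι → ℝ) := fun l => (fun x => x + e l) ⁻¹' B l
  have hT : ∀ l, MeasurableSet (T l) := fun l => (measurable_add_const (e l)) (hB l)
  have hdisj : Pairwise (Function.onFun Disjoint T) := by
    intro l l' hll
    refine Set.disjoint_left.2 fun x hx hx' => hll ?_
    obtain ⟨⟨⟨a, ha, _, ⟨m, hm, rfl⟩, h1⟩, _⟩, _⟩ := hx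
    obtain ⟨⟨⟨a', ha', _, ⟨m', hm', rfl⟩, h2⟩, _⟩, _⟩ := hx'
    -- This integer vector is a - a'. Its coordinate k is l - l', since m and m' vanish at k.
    have := hinj a ha a' ha' (fun j => m' j - m j + (Pi.single k (l - l') : ι → ℤ) j) ?_ ?_
    · simp [hm k hpk, hm' k hpk] at this
      omega
    · intro j hj
      rw [hq, not_or] at hj
      simp [hm j hj.1, hm' j hj.1, hj.2]
    · ext j
      have h1 := congrFun h1 j
      have h2 := congrFun h2 j
      simp only [Pi.add_apply, he] at h1 h2
      by_cases hj : j = k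
      · subst hj
        simp at h1 h2 ⊢
        linarith
      · simp [hj] at h1 h2 ⊢
        linarith
  calc foldVolume p A ≤ volume (⋃ l, B l) := measure_mono fun x hx => by
        simpa [B] using hx
    _ ≤ ∑' l, volume (B l) := measure_iUnion_le _
    _ = ∑' l, volume (T l) := by
        congr 1; ext l; exact (measure_preimage_add_right volume (e l) (B l)).symm
    _ = volume (⋃ l, T l) := (measure_iUnion hdisj hT).symm
    _ ≤ foldVolume q A := by
        refine measure_mono (Set.iUnion_subset fun l x hx => ?_)
        obtain ⟨⟨⟨a, ha, _, ⟨m, hm, rfl⟩, h1⟩, h2⟩, h3⟩ := hx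
        refine ⟨⟨a, ha, _, ⟨fun j => m j - (Pi.single k l : ι → ℤ) j, ?_, rfl⟩, ?_⟩, ?_⟩
        · intro j hj
          rw [hq, not_or] at hj
          simp [hm j hj.1, hj.2]
        · ext j
          have h1 := congrFun h1 j
          by_cases hj : j = k
          · subst hj; simp [he] at h1 ⊢; linarith
          · simp [he, hj] at h1 ⊢; linarith
        · intro j hj
          by_cases hjk : j = k
          · subst hjk
            simp only [Set.mem_ofPred_eq, Pi.add_apply, he, Pi.single_eq_same,
              Int.floor_add_intCast, add_eq_right] at h3
            exact Set.mem_Ico.2 (Int.floor_eq_zero_iff.1 h3)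
          · have := h2 j (((hq j).1 hj).resolve_right hjk)
            simpa [he, hjk] using this

/-- **Minkowski's second theorem** in coordinates adapted to the successive minima `s 0 ≤ s 1 ≤ …`
of the difference body. -/
theorem ofReal_prod_mul_volume_le_one {n : ℕ} {O : Set (Fin n → ℝ)} (hO : IsOpen O)
    (hconv : Convex ℝ O) {s : ℕ → ℝ} (hpos : ∀ i < n, 0 < s i)
    (hmono : ∀ i, i + 1 < n → s i ≤ s (i + 1))
    (h : ∀ i < n, ∀ m : Fin n → ℤ, (fun j => (m j : ℝ)) ∈ s i • (O - O) →
      ∀ j : Fin n, i ≤ j → m j = 0) :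
    ENNReal.ofReal (∏ i ∈ Finset.range n, s i) * volume O ≤ 1 := by
  have hstep : ∀ i < n, foldVolume (fun j : Fin n => (j : ℕ) < i) (s i • O) ≤
      foldVolume (fun j : Fin n => (j : ℕ) < i + 1) (s i • O) := by
    intro i hi
    refine foldVolume_le_foldVolume_insert (k := ⟨i, hi⟩) (by simp) (fun j => ?_)
      (hO.smul₀ (hpos i hi).ne') ?_
    · rw [Fin.ext_iff, Nat.lt_succ_iff_lt_or_eq]
    · rintro _ ⟨a, ha, rfl⟩ _ ⟨b, hb, rfl⟩ m _ hab
      refine h i hi m ?_ _ le_rfl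
      rw [← hab]
      exact ⟨a - b, Set.sub_mem_sub ha hb, smul_sub _ _ _⟩
  -- Passing from i to i + 1 folds one coordinate without loss, then dilates by s (i+1) / s i with n
  -- - i - 1 coordinates unfolded. This turns s_i^(n-i) into s_i · s_{i+1}^(n-i-1).
  have hmain : ∀ i < n, ENNReal.ofReal ((∏ j ∈ Finset.range i, s j) * s i ^ (n - i)) * volume O ≤
      foldVolume (fun j : Fin n => (j : ℕ) < i) (s i • O) := by
    intro i
    induction i with
    | zero =>
      intro hi
      simp only [Nat.not_lt_zero]
      rw [foldVolume_false, Measure.addHaar_smul_of_nonneg _ (hpos 0 hi).le]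
      simp
    | succ i ih =>
      intro hi
      have hi' : i < n := by omega
      have h0 := hpos i hi'
      have h1 := foldVolume_smul_ge (fun j : Fin n => (j : ℕ) < i + 1) (hO.smul₀ h0.ne')
        (hconv.smul (s i)) (c := s (i + 1) / s i) ((one_le_div h0).2 (hmono i hi))
      rw [smul_smul, div_mul_cancel₀ _ h0.ne'] at h1
      refine le_trans ?_ h1
      refine le_trans ?_ (mul_le_mul_right ((ih hi').trans (hstep i hi')) _)
      rw [← mul_assoc, ← ENNReal.ofReal_mul (by have := hpos _ hi; positivity)]
      refine mul_le_mul_left (ENNReal.ofReal_le_ofReal (le_of_eq ?_)) _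
      have hcard : Fintype.card {j : Fin n // ¬ (j : ℕ) < i + 1} = n - (i + 1) := by
        rw [Fintype.card_subtype_compl, Fintype.card_fin]
        congr 1
        rw [Fintype.card_subtype]
        have := Fin.card_filter_val_lt (m := i + 1) (n := n)
        simpa [min_eq_right hi.le, min_eq_left hi.le] using this
      rw [hcard, Finset.prod_range_succ, show n - i = n - (i + 1) + 1 by omega, div_pow, pow_succ]
      field_simp
  rcases n with _ | n
  · simp only [Finset.range_zero, Finset.prod_empty, ENNReal.ofReal_one, one_mul]
    exact (measure_mono (Set.subset_univ O)).trans (by simp [volume_pi])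
  -- Folding the last coordinate puts everything in the unit cube.
  · have h1 := (hmain n (by omega)).trans (hstep n (by omega))
    simp only [Fin.is_lt] at h1
    rw [Finset.prod_range_succ]
    simpa using h1.trans (foldVolume_true_le_one _)

/-! ### Symmetric bodies -/

/-- A compact convex neighbourhood of the origin that is symmetric about it. -/
structure IsSymmetricBody {E : Type*} [NormedAddCommGroup E] [NormedSpace ℝ E] (D : Set E) :
    Prop where
  convex : Convex ℝ D
  isCompact : IsCompact D
  mem_nhds : D ∈ nhds (0 : E)
  neg_mem : ∀ x ∈ D, -x ∈ D

namespace IsSymmetricBody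

variable {E : Type*} [NormedAddCommGroup E] [NormedSpace ℝ E] {D : Set E}

theorem zero_mem (hD : IsSymmetricBody D) : (0 : E) ∈ D := mem_of_mem_nhds hD.mem_nhds

theorem smul_mem (hD : IsSymmetricBody D) {x : E} (hx : x ∈ D) {c : ℝ} (hc : |c| ≤ 1) :
    c • x ∈ D := by
  rcases le_total 0 c with h | h
  · exact hD.convex.smul_mem_of_zero_mem hD.zero_mem hx ⟨h, (le_abs_self c).trans hc⟩
  · have := hD.convex.smul_mem_of_zero_mem hD.zero_mem (hD.neg_mem x hx)
      (t := -c) ⟨by linarith, (neg_le_abs c).trans hc⟩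
    simpa using this

theorem smul_mono (hD : IsSymmetricBody D) {s t : ℝ} (hs : 0 ≤ s) (hst : s ≤ t) :
    s • D ⊆ t • D := by
  rintro _ ⟨x, hx, rfl⟩
  rcases eq_or_lt_of_le (hs.trans hst) with h | h
  · have : s = t := by linarith
    rw [this]; exact ⟨x, hx, rfl⟩
  · refine ⟨(s / t) • x, hD.smul_mem hx ?_, ?_⟩
    · rw [abs_of_nonneg (by positivity)]; exact div_le_one_of_le₀ hst h.le
    · simp only [smul_smul]; congr 1; field_simp

theorem exists_mem_smul (hD : IsSymmetricBody D) (x : E) : ∃ R : ℝ, 0 < R ∧ x ∈ R • D := by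
  obtain ⟨R, hR, h⟩ := (absorbent_nhds_zero (𝕜 := ℝ) hD.mem_nhds x).exists_pos
  exact ⟨R, hR, h R (by simp [abs_of_pos hR]) (Set.mem_singleton x)⟩

end IsSymmetricBody

theorem IsConvexBody.isSymmetricBody_sub {n : ℕ} {K : Set (EuclideanSpace ℝ (Fin n))}
    (hK : IsConvexBody K) : IsSymmetricBody (K - K) where
  convex := hK.convex.sub hK.convex
  isCompact := sub_eq_add_neg K K ▸ hK.isCompact.add hK.isCompact.neg
  mem_nhds := by
    obtain ⟨x, hx⟩ := hK.nonempty_interior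
    have hopen : IsOpen (interior K - interior K) := isOpen_interior.sub_right
    exact Filter.mem_of_superset (hopen.mem_nhds ⟨x, hx, x, hx, sub_self x⟩)
      (Set.sub_subset_sub interior_subset interior_subset)
  neg_mem := by
    rintro _ ⟨x, hx, y, hy, rfl⟩
    exact ⟨y, hy, x, hx, (neg_sub x y).symm⟩

theorem range_fin_eq_image_Iio {E : Type*} (b : ℕ → E) (i : ℕ) :
    Set.range (fun j : Fin i => b j) = b '' Set.Iio i := by
  ext x
  constructor
  · rintro ⟨j, rfl⟩; exact ⟨j, j.2, rfl⟩
  · rintro ⟨j, hj, rfl⟩; exact ⟨⟨j, hj⟩, rfl⟩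

/-! ### Minimal dilations and greedy lattice bases -/

section Lattice

variable {E : Type*} [NormedAddCommGroup E] [NormedSpace ℝ E]

theorem exists_mem_span_int_norm_sub_le {S : Set E} (hS : S.Finite) :
    ∃ M : ℝ, ∀ x ∈ Submodule.span ℝ S, ∃ s ∈ Submodule.span ℤ S, ‖x - s‖ ≤ M := by
  lift S to Finset E using hS
  refine ⟨∑ a ∈ S, ‖a‖, fun x hx => ?_⟩
  obtain ⟨f, -, rfl⟩ := Submodule.mem_span_finset.1 hx
  refine ⟨∑ a ∈ S, ⌊f a⌋ • a, Submodule.sum_mem _ fun a ha =>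
    Submodule.smul_mem _ _ (Submodule.subset_span ha), ?_⟩
  rw [← Finset.sum_sub_distrib]
  refine (norm_sum_le _ _).trans (Finset.sum_le_sum fun a _ => ?_)
  rw [← Int.cast_smul_eq_zsmul ℝ, ← sub_smul, norm_smul, Int.self_sub_floor, Real.norm_eq_abs,
    abs_of_nonneg (Int.fract_nonneg _)]
  exact mul_le_of_le_one_left (norm_nonneg a) (Int.fract_lt_one _).le

/-- The minimum is that of ρ on the compact set of pairs (ρ, d), with ρ ≤ R and d in D, for which
some x - ρd lies in L. -/
theorem exists_min_dilation [FiniteDimensional ℝ E] {D : Set E} (hD : IsCompact D)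
    (L : Submodule ℝ E) {F : Set E} (hF : F.Finite) {R : ℝ} (hR : 0 ≤ R)
    (hne : ∃ x ∈ F, x ∈ R • D + (L : Set E)) :
    ∃ μ : ℝ, 0 ≤ μ ∧ (∃ x ∈ F, x ∈ μ • D + (L : Set E)) ∧
      ∀ ρ : ℝ, 0 ≤ ρ → ∀ x ∈ F, x ∈ ρ • D + (L : Set E) → μ ≤ ρ := by
  have hL : IsClosed (L : Set E) := L.closed_of_finiteDimensional
  set Z : Set (ℝ × E) := (Set.Icc 0 R ×ˢ D) ∩ ⋃ x ∈ F, {q | x - q.1 • q.2 ∈ L}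
  have hZ : IsCompact Z := by
    refine (isCompact_Icc.prod hD).inter_right (hF.isClosed_biUnion fun x _ => ?_)
    exact hL.preimage (f := fun q : ℝ × E => x - q.1 • q.2) (by fun_prop)
  have hmem : ∀ ρ ∈ Set.Icc 0 R, ∀ x ∈ F, x ∈ ρ • D + (L : Set E) → ∃ d, (ρ, d) ∈ Z := by
    rintro ρ hρ x hx ⟨_, ⟨d, hd, rfl⟩, l, hl, rfl⟩
    exact ⟨d, ⟨hρ, hd⟩, Set.mem_biUnion hx (by simpa using hl)⟩
  obtain ⟨x₀, hx₀, h₀⟩ := hne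
  obtain ⟨d₀, hd₀⟩ := hmem R ⟨hR, le_rfl⟩ x₀ hx₀ h₀
  obtain ⟨⟨μ, d⟩, hμ, hmin⟩ := hZ.exists_isMinOn ⟨_, hd₀⟩ continuous_fst.continuousOn
  have hμR : μ ∈ Set.Icc 0 R := hμ.1.1
  refine ⟨μ, hμR.1, ?_, fun ρ hρ x hx h => ?_⟩
  · obtain ⟨x, hx, h⟩ := Set.mem_iUnion₂.1 hμ.2
    exact ⟨x, hx, μ • d, ⟨d, hμ.1.2, rfl⟩, x - μ • d, h, add_sub_cancel _ _⟩
  · rcases le_total ρ R with h' | h'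
    · obtain ⟨d', hd'⟩ := hmem ρ ⟨hρ, h'⟩ x hx h
      exact hmin hd'
    · exact hμR.2.trans h'

/-- T is stable under the integer span of S, so rounding the component in the real span of S moves
candidates into a bounded region, where only finitely many lattice points lie. The minimum is
positive because a zero dilation would put a point of T in the span of S. Taking S empty gives
ordinary dilates of D. -/
theorem exists_min_dilation_lattice [FiniteDimensional ℝ E] {D : Set E} (hD : IsSymmetricBody D)
    (Λ : Submodule ℤ E) [DiscreteTopology Λ] {S : Set E} (hS : S.Finite) {T : Set E}
    (hTΛ : T ⊆ Λ) (hTS : ∀ x ∈ T, ∀ s ∈ Submodule.span ℤ S, x - s ∈ T)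
    (hT : ∀ x ∈ T, x ∉ Submodule.span ℝ S) (hne : T.Nonempty) :
    ∃ μ : ℝ, 0 < μ ∧ (∃ b ∈ T, b ∈ μ • D + (Submodule.span ℝ S : Set E)) ∧
      ∀ ρ : ℝ, 0 < ρ → ∀ x ∈ T, x ∈ ρ • D + (Submodule.span ℝ S : Set E) → μ ≤ ρ := by
  obtain ⟨v, hv⟩ := hne
  obtain ⟨R, hR, hvR⟩ := hD.exists_mem_smul v
  obtain ⟨M, hM⟩ := exists_mem_span_int_norm_sub_le hS
  obtain ⟨N, hN⟩ := hD.isCompact.isBounded.exists_norm_le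
  set F := T ∩ Metric.closedBall 0 (R * N + M)
  have hF : F.Finite := by
    have : IsClosed (Λ : Set E) := by
      rw [← Submodule.coe_toAddSubgroup]
      have : DiscreteTopology Λ.toAddSubgroup := ‹DiscreteTopology Λ›
      exact AddSubgroup.isClosed_of_discrete
    refine (Metric.finite_isBounded_inter_isClosed DiscreteTopology.isDiscrete
      (Metric.isBounded_closedBall (x := (0 : E)) (r := R * N + M)) this).subset ?_
    exact fun x hx => ⟨hx.2, hTΛ hx.1⟩
  have hred : ∀ ρ : ℝ, 0 ≤ ρ → ρ ≤ R → ∀ x ∈ T, x ∈ ρ • D + (Submodule.span ℝ S : Set E) →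
      ∃ x' ∈ F, x' ∈ ρ • D + (Submodule.span ℝ S : Set E) := by
    rintro ρ hρ hρR x hx ⟨_, ⟨d, hd, rfl⟩, l, hl, rfl⟩
    obtain ⟨s, hs, hsM⟩ := hM l hl
    refine ⟨_, ⟨hTS _ hx s hs, ?_⟩, ρ • d, ⟨d, hd, rfl⟩, l - s, ?_, (add_sub_assoc _ _ _).symm⟩
    · rw [mem_closedBall_zero_iff, add_sub_assoc]
      refine (norm_add_le _ _).trans (add_le_add ?_ hsM)
      simp only [norm_smul, Real.norm_eq_abs, abs_of_nonneg hρ]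
      exact mul_le_mul hρR (hN d hd) (norm_nonneg _) hR.le
    · exact sub_mem hl (Submodule.span_le_restrictScalars ℤ ℝ S hs)
  have hvR' : v ∈ R • D + (Submodule.span ℝ S : Set E) := ⟨v, hvR, 0, zero_mem _, add_zero v⟩
  obtain ⟨μ, hμ0, ⟨b, hbF, hb⟩, hmin⟩ := exists_min_dilation hD.isCompact (Submodule.span ℝ S) hF
    hR.le (hred R hR.le le_rfl v hv hvR')
  have hμR : μ ≤ R := by
    obtain ⟨x', hx', h'⟩ := hred R hR.le le_rfl v hv hvR'
    exact hmin R hR.le x' hx' h'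
  refine ⟨μ, lt_of_le_of_ne hμ0 ?_, ⟨b, hbF.1, hb⟩, fun ρ hρ x hx h => ?_⟩
  · rintro rfl
    obtain ⟨_, ⟨d, hd, rfl⟩, l, hl, rfl⟩ := hb
    exact hT _ hbF.1 (by simpa using hl)
  · rcases le_total ρ R with h' | h'
    · obtain ⟨x', hx', h''⟩ := hred ρ hρ.le h' x hx h
      exact hmin ρ hρ.le x' hx' h''
    · exact hμR.trans h'

/-- A finite subset of the lattice that generates all lattice points in its real span. -/
structure IsAdapted (Λ : Submodule ℤ E) (S : Set E) : Prop where
  finite : S.Finite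
  subset : S ⊆ Λ
  mem_span_int : ∀ x ∈ Λ, x ∈ Submodule.span ℝ S → x ∈ Submodule.span ℤ S

theorem isAdapted_empty (Λ : Submodule ℤ E) : IsAdapted Λ ∅ :=
  ⟨Set.finite_empty, Set.empty_subset _, fun x _ hx => by simpa using hx⟩

/-- A minimal b generates: subtracting the nearest integer multiple of b from a lattice point leaves
cb + l with |c| ≤ 1/2. Outside the span of S this would be reached by the dilation |c|μ < μ, so it
lies in the span, where S already generates. The subspace W lets the new vector be confined to a
prescribed direction modulo the span of S. -/
theorem IsAdapted.exists_insert [FiniteDimensional ℝ E] {D : Set E} (hD : IsSymmetricBody D)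
    {Λ : Submodule ℤ E} [DiscreteTopology Λ] {S : Set E} (hS : IsAdapted Λ S)
    {W : Submodule ℝ E} (hW : Submodule.span ℝ S ≤ W)
    (hne : ∃ v ∈ Λ, v ∈ W ∧ v ∉ Submodule.span ℝ S) :
    ∃ b ∈ W, b ∉ Submodule.span ℝ S ∧ IsAdapted Λ (insert b S) ∧
      ∃ μ : ℝ, 0 < μ ∧ b ∈ μ • D + (Submodule.span ℝ S : Set E) ∧
        ∀ ρ : ℝ, 0 < ρ → ∀ x ∈ Λ, x ∈ W → x ∉ Submodule.span ℝ S →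
          x ∈ ρ • D + (Submodule.span ℝ S : Set E) → μ ≤ ρ := by
  set L := Submodule.span ℝ S
  have hSL : Submodule.span ℤ S ≤ L.restrictScalars ℤ := Submodule.span_le_restrictScalars ℤ ℝ S
  have hSΛ : Submodule.span ℤ S ≤ Λ := Submodule.span_le.2 hS.subset
  obtain ⟨v, hvΛ, hvW, hvL⟩ := hne
  obtain ⟨μ, hμ, ⟨b, ⟨hbΛ, hbW, hbL⟩, hb⟩, hmin⟩ := exists_min_dilation_lattice hD Λ hS.finite
    (T := {x | x ∈ Λ ∧ x ∈ W ∧ x ∉ L}) (fun x hx => hx.1)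
    (fun x hx s hs => ⟨sub_mem hx.1 (hSΛ hs), sub_mem hx.2.1 (hW (hSL hs)),
      fun h => hx.2.2 (by simpa using add_mem h (hSL hs))⟩)
    (fun x hx => hx.2.2) ⟨v, hvΛ, hvW, hvL⟩
  refine ⟨b, hbW, hbL, ⟨hS.finite.insert b, Set.insert_subset hbΛ hS.subset, fun x hx hxs => ?_⟩,
    μ, hμ, hb, fun ρ hρ x hx hxW hxL h => hmin ρ hρ x ⟨hx, hxW, hxL⟩ h⟩
  obtain ⟨a, l, hl, rfl⟩ := Submodule.mem_span_insert.1 hxs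
  set c : ℝ := a - round a with hc
  have hdecomp : a • b + l - (round a : ℤ) • b = c • b + l := by
    rw [← Int.cast_smul_eq_zsmul ℝ, hc, sub_smul]; abel
  have hx' : c • b + l ∈ Λ := by
    rw [← hdecomp]; exact sub_mem hx (Λ.smul_mem _ hbΛ)
  have hcle : |c| ≤ 1 / 2 := abs_sub_round a
  have hL : c • b + l ∈ L := by
    by_contra hnot
    have hc0 : 0 < |c| := by
      rw [abs_pos]
      intro h0
      exact hnot (by simpa [h0] using hl)
    have := hmin (|c| * μ) (by positivity) (c • b + l)
      ⟨hx', W.add_mem (W.smul_mem _ hbW) (hW hl), hnot⟩ (by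
        obtain ⟨_, ⟨d, hd, rfl⟩, l', hl', rfl⟩ := hb
        -- The sign of c is absorbed into d by the symmetry of D, leaving the positive factor |c|μ.
        have hsign : abs (c / |c|) ≤ 1 := by rw [abs_div, abs_abs, div_self hc0.ne']
        refine ⟨(|c| * μ) • (c / |c|) • d, ⟨_, hD.smul_mem hd hsign, rfl⟩, c • l' + l,
          L.add_mem (L.smul_mem _ hl') hl, ?_⟩
        simp only [smul_smul, smul_add]
        rw [show |c| * μ * (c / |c|) = c * μ by field_simp]
        abel)
    nlinarith
  have := hS.mem_span_int _ hx' hL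
  rw [← hdecomp] at this
  have h2 := add_mem (Submodule.span_mono (Set.subset_insert b S) this)
    (Submodule.smul_mem (Submodule.span ℤ (insert b S)) (round a)
      (Submodule.subset_span (Set.mem_insert b S)))
  simpa using h2

/-- The property Q is left open so that the greedy constructions for both bounds share one
recursion. -/
theorem exists_adapted_sequence [FiniteDimensional ℝ E] {n : ℕ} (hn : finrank ℝ E = n)
    {Λ : Submodule ℤ E} (Q : Submodule ℝ E → E → Prop)
    (hstep : ∀ S, IsAdapted Λ S → Submodule.span ℝ S ≠ ⊤ →
      ∃ b, b ∉ Submodule.span ℝ S ∧ IsAdapted Λ (insert b S) ∧ Q (Submodule.span ℝ S) b) :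
    ∃ b : ℕ → E, LinearIndependent ℝ (fun j : Fin n => b j) ∧ IsAdapted Λ (b '' Set.Iio n) ∧
      ∀ i < n, Q (Submodule.span ℝ (b '' Set.Iio i)) (b i) := by
  have hstep' : ∀ S : Set E, ∃ b, IsAdapted Λ S → Submodule.span ℝ S ≠ ⊤ →
      b ∉ Submodule.span ℝ S ∧ IsAdapted Λ (insert b S) ∧ Q (Submodule.span ℝ S) b := by
    intro S
    by_cases h : IsAdapted Λ S ∧ Submodule.span ℝ S ≠ ⊤
    · obtain ⟨b, hb⟩ := hstep S h.1 h.2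
      exact ⟨b, fun _ _ => hb⟩
    -- A default value, which makes the choice total for the recursion on sets.
    · exact ⟨0, fun h1 h2 => (h ⟨h1, h2⟩).elim⟩
  choose c hc using hstep'
  set s : ℕ → Set E := fun i => Nat.rec ∅ (fun _ S => insert (c S) S) i with hs
  set b : ℕ → E := fun i => c (s i) with hb
  have himg : ∀ i, b '' Set.Iio i = s i := by
    intro i
    induction i with
    | zero => simp [hs]
    | succ i ih =>
      have : Set.Iio (i + 1) = insert i (Set.Iio i) := by ext; simp
      rw [this, Set.image_insert_eq, ih]
  have hmain : ∀ i ≤ n, LinearIndependent ℝ (fun j : Fin i => b j) ∧ IsAdapted Λ (s i) ∧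
      ∀ k < i, Q (Submodule.span ℝ (s k)) (b k) := by
    intro i
    induction i with
    | zero => exact fun _ => ⟨linearIndependent_empty_type, isAdapted_empty Λ, by simp⟩
    | succ i ih =>
      intro hi
      obtain ⟨h1, h2, h3⟩ := ih (by omega)
      have hrange : Set.range (fun j : Fin i => b j) = s i := by
        rw [range_fin_eq_image_Iio, himg]
      have htop : Submodule.span ℝ (s i) ≠ ⊤ := by
        intro htop
        have := finrank_span_eq_card h1
        rw [hrange, htop, finrank_top, hn, Fintype.card_fin] at this
        omega
      obtain ⟨h4, h5, h6⟩ := hc (s i) h2 htop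
      refine ⟨linearIndependent_finSucc'.2 ⟨h1, ?_⟩, h5, fun k hk => ?_⟩
      · have : Set.range (Fin.init fun j : Fin (i + 1) => b j) = s i := hrange
        rw [this]
        exact h4
      · rcases Nat.lt_succ_iff_lt_or_eq.1 hk with h | rfl
        · exact h3 k h
        · exact h6
  obtain ⟨h1, h2, h3⟩ := hmain n le_rfl
  refine ⟨b, h1, (himg n).symm ▸ h2, fun i hi => ?_⟩
  rw [himg]
  exact h3 i hi

theorem exists_intBasis [FiniteDimensional ℝ E] {n : ℕ} (hn : finrank ℝ E = n)
    {Λ : Submodule ℤ E} {b : ℕ → E} (hli : LinearIndependent ℝ (fun j : Fin n => b j))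
    (hb : IsAdapted Λ (b '' Set.Iio n)) :
    ∃ B : Basis (Fin n) ℤ Λ, ∀ j, (B j : E) = b j := by
  have hmem : ∀ j : Fin n, b j ∈ Λ := fun j => hb.subset ⟨j, j.2, rfl⟩
  set v : Fin n → Λ := fun j => ⟨b j, hmem j⟩
  have hv : LinearIndependent ℤ v := by
    have h1 : LinearIndependent ℤ (fun j : Fin n => b j) :=
      hli.restrict_scalars (smul_left_injective ℤ one_ne_zero)
    exact LinearIndependent.of_comp Λ.subtype h1
  have htop : Submodule.span ℝ (b '' Set.Iio n) = ⊤ := by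
    rw [← range_fin_eq_image_Iio]
    exact hli.span_eq_top_of_card_eq_finrank' (by simp [hn])
  have hspan : ⊤ ≤ Submodule.span ℤ (Set.range v) := by
    rintro ⟨x, hx⟩ -
    have := hb.mem_span_int x hx (htop ▸ Submodule.mem_top)
    rw [← range_fin_eq_image_Iio] at this
    have h2 : Set.range (fun j : Fin n => b j) = Λ.subtype '' Set.range v := by
      rw [← Set.range_comp]; rfl
    rw [h2, Submodule.span_image] at this
    obtain ⟨y, hy, hyx⟩ := this
    have : y = ⟨x, hx⟩ := Subtype.ext hyx
    rwa [← this]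
  exact ⟨Basis.mk hv hspan, fun j => by simp [v]⟩

end Lattice

/-! ### Criteria for the packing minima -/

/-- The set of dilation factors whose infimum is `packingMin K Λ i`. -/
def packingSet {n : ℕ} (K : Set (EuclideanSpace ℝ (Fin n)))
    (Λ : Submodule ℤ (EuclideanSpace ℝ (Fin n))) (i : ℕ) : Set ℝ :=
  {ρ : ℝ | 0 < ρ ∧ ∀ L : Submodule ℝ (EuclideanSpace ℝ (Fin n)), finrank ℝ L + i = n →
    (ρ • (K - K) + (L : Set (EuclideanSpace ℝ (Fin n)))) ∩ (Λ : Set (EuclideanSpace ℝ (Fin n))) ≠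
      (L : Set (EuclideanSpace ℝ (Fin n))) ∩ (Λ : Set (EuclideanSpace ℝ (Fin n)))}

section PackingSet

variable {n : ℕ} {K : Set (EuclideanSpace ℝ (Fin n))}
  {Λ : Submodule ℤ (EuclideanSpace ℝ (Fin n))} {i : ℕ}

theorem packingMin_le {ρ : ℝ} (h : ρ ∈ packingSet K Λ i) : packingMin K Λ i ≤ ρ :=
  csInf_le ⟨0, fun _ h => h.1.le⟩ h

theorem mem_packingSet {ρ : ℝ} (hρ : 0 < ρ)
    (h : ∀ L : Submodule ℝ (EuclideanSpace ℝ (Fin n)), finrank ℝ L + i = n →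
      ∃ x ∈ Λ, x ∉ L ∧ x ∈ ρ • (K - K)) : ρ ∈ packingSet K Λ i := by
  refine ⟨hρ, fun L hL heq => ?_⟩
  obtain ⟨x, hx, hxL, hxK⟩ := h L hL
  have : x ∈ (L : Set (EuclideanSpace ℝ (Fin n))) ∩ (Λ : Set (EuclideanSpace ℝ (Fin n))) :=
    heq ▸ ⟨⟨x, hxK, 0, zero_mem L, add_zero x⟩, hx⟩
  exact hxL this.1

/-- A single subspace suffices for a lower bound, whereas membership in `packingSet` has to be
checked against all of them. -/
theorem le_of_mem_packingSet (hK : IsConvexBody K)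
    {L : Submodule ℝ (EuclideanSpace ℝ (Fin n))} (hL : finrank ℝ L + i = n) {μ : ℝ}
    (h : ∀ ρ : ℝ, 0 < ρ → ∀ x ∈ Λ, x ∉ L →
      x ∈ ρ • (K - K) + (L : Set (EuclideanSpace ℝ (Fin n))) → μ ≤ ρ)
    {ρ : ℝ} (hρ : ρ ∈ packingSet K Λ i) : μ ≤ ρ := by
  by_contra hlt
  refine hρ.2 L hL (Set.Subset.antisymm ?_ ?_)
  · rintro x ⟨hx, hxΛ⟩
    refine ⟨?_, hxΛ⟩
    by_contra hxL
    exact hlt (h ρ hρ.1 x hxΛ hxL hx)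
  · rintro x ⟨hx, hxΛ⟩
    exact ⟨⟨0, ⟨0, hK.isSymmetricBody_sub.zero_mem, smul_zero ρ⟩, x, hx, zero_add x⟩, hxΛ⟩

end PackingSet

theorem exists_mem_lattice_notMem {E : Type*} [NormedAddCommGroup E] [NormedSpace ℝ E]
    (Λ : Submodule ℤ E) [DiscreteTopology Λ] [IsZLattice ℝ Λ] {L : Submodule ℝ E} (hL : L ≠ ⊤) :
    ∃ v ∈ Λ, v ∉ L := by
  by_contra! h
  have := IsZLattice.span_top (K := ℝ) (L := Λ)
  exact hL (top_le_iff.1 (this ▸ Submodule.span_le.2 h))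

/-! ### The two inequalities -/

section Bounds

variable {n : ℕ} {Λ : Submodule ℤ (EuclideanSpace ℝ (Fin n))} [DiscreteTopology Λ]
  [IsZLattice ℝ Λ]

theorem repr_eq_zero_of_mem_span {B : Basis (Fin n) ℤ Λ} {b : ℕ → EuclideanSpace ℝ (Fin n)}
    (hB : ∀ j, (B j : EuclideanSpace ℝ (Fin n)) = b j) {i : ℕ} (hi : i ≤ n)
    {x : EuclideanSpace ℝ (Fin n)} (hx : x ∈ Submodule.span ℝ (b '' Set.Iio i)) {j : Fin n}
    (hj : i ≤ j) : (B.ofZLatticeBasis ℝ Λ).equivFun x j = 0 := by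
  have himg : b '' Set.Iio i = B.ofZLatticeBasis ℝ Λ '' {j : Fin n | (j : ℕ) < i} := by
    ext y
    constructor
    · rintro ⟨k, hk, rfl⟩
      exact ⟨⟨k, lt_of_lt_of_le hk hi⟩, hk, by rw [Basis.ofZLatticeBasis_apply, hB]⟩
    · rintro ⟨k, hk, rfl⟩
      exact ⟨k, hk, by rw [Basis.ofZLatticeBasis_apply, hB]⟩
  rw [himg, Basis.mem_span_image] at hx
  rw [Basis.equivFun_apply]
  by_contra hne
  have : j ∈ {j : Fin n | (j : ℕ) < i} := hx (Finsupp.mem_support_iff.2 hne)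
  exact absurd this (not_lt.2 hj)

theorem finrank_span_image_Iio {b : ℕ → EuclideanSpace ℝ (Fin n)}
    (hli : LinearIndependent ℝ (fun j : Fin n => b j)) {i : ℕ} (hi : i ≤ n) :
    finrank ℝ (Submodule.span ℝ (b '' Set.Iio i)) = i := by
  have h := finrank_span_eq_card (hli.comp (Fin.castLE hi) (Fin.castLE_injective hi))
  rw [Fintype.card_fin] at h
  rw [← range_fin_eq_image_Iio]
  exact h

theorem exists_lower_minima {K : Set (EuclideanSpace ℝ (Fin n))} (hK : IsConvexBody K) :
    ∃ μ : ℕ → ℝ, (∀ i < n, 0 < μ i) ∧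
      (∀ i < n, ∀ ρ ∈ packingSet K Λ (n - i), μ i ≤ ρ) ∧
      (∏ i ∈ Finset.range n, 1 / μ i) / (n ! : ℝ) ≤ volume.real K / ZLattice.covolume Λ := by
  have hD := hK.isSymmetricBody_sub
  obtain ⟨b, hli, had, hQ⟩ := exists_adapted_sequence (Λ := Λ)
    (finrank_euclideanSpace_fin (𝕜 := ℝ) (n := n))
    (fun L b => ∃ μ : ℝ, 0 < μ ∧ b ∈ μ • (K - K) + (L : Set (EuclideanSpace ℝ (Fin n))) ∧
      ∀ ρ : ℝ, 0 < ρ → ∀ x ∈ Λ, x ∉ L →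
        x ∈ ρ • (K - K) + (L : Set (EuclideanSpace ℝ (Fin n))) → μ ≤ ρ)
    (fun S hS hne => by
      obtain ⟨v, hv, hvS⟩ := exists_mem_lattice_notMem Λ hne
      obtain ⟨b, -, hbS, hbad, μ, hμ, hb, hmin⟩ := hS.exists_insert hD (W := ⊤) le_top
        ⟨v, hv, Submodule.mem_top, hvS⟩
      exact ⟨b, hbS, hbad, μ, hμ, hb, fun ρ hρ x hx hxL h =>
        hmin ρ hρ x hx Submodule.mem_top hxL h⟩)
  have hQ' : ∀ i, ∃ μ : ℝ, i < n → 0 < μ ∧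
      b i ∈ μ • (K - K) + (Submodule.span ℝ (b '' Set.Iio i) : Set (EuclideanSpace ℝ (Fin n))) ∧
      ∀ ρ : ℝ, 0 < ρ → ∀ x ∈ Λ, x ∉ Submodule.span ℝ (b '' Set.Iio i) →
        x ∈ ρ • (K - K) + (Submodule.span ℝ (b '' Set.Iio i) : Set (EuclideanSpace ℝ (Fin n))) →
          μ ≤ ρ := by
    intro i
    by_cases hi : i < n
    · obtain ⟨μ, h⟩ := hQ i hi
      exact ⟨μ, fun _ => h⟩
    · exact ⟨0, fun h => (hi h).elim⟩
  choose μ hμ using hQ'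
  obtain ⟨B, hB⟩ := exists_intBasis (finrank_euclideanSpace_fin (𝕜 := ℝ) (n := n)) hli had
  refine ⟨μ, fun i hi => (hμ i hi).1, fun i hi ρ hρ => ?_, ?_⟩
  · refine le_of_mem_packingSet hK (L := Submodule.span ℝ (b '' Set.Iio i)) ?_ (hμ i hi).2.2 hρ
    rw [finrank_span_image_Iio hli hi.le]; omega
  set e := (B.ofZLatticeBasis ℝ Λ).equivFun
  have hcont : Continuous e := LinearMap.continuous_of_finiteDimensional e.toLinearMap
  have hvol := ZLattice.volume_image_eq_volume_div_covolume' Λ B (s := K)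
    hK.isCompact.measurableSet.nullMeasurableSet
  have hfin : volume K ≠ ⊤ := hK.isCompact.measure_lt_top.ne
  have hkey := ofReal_prod_div_factorial_le_volume (K := e '' K)
    (hK.convex.linear_image e.toLinearMap) (hK.isCompact.image hcont)
    ((hK.nonempty_interior.mono interior_subset).image _) (d := fun i => 1 / μ i)
    (fun i => one_div_nonneg.2 (hμ i i.2).1.le) (fun i => by
      obtain ⟨hpos, ⟨_, ⟨_, ⟨y, hy, x, hx, rfl⟩, rfl⟩, l, hl, hbi⟩, -⟩ := hμ i i.2
      -- Modulo L_i the segment from x to y is b_i/μ_i, and L_i has no coordinates of index i or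
      -- higher: this is the triangular shape.
      have hyx : y - x = (1 / μ i) • (b i - l) := by
        rw [← hbi]
        simp only [add_sub_cancel_right, smul_smul]
        rw [one_div_mul_cancel hpos.ne', one_smul]
      have hcoord : ∀ j : Fin n, i ≤ j → e y j - e x j = (1 / μ i) * e (b i) j := by
        intro j hj
        rw [← Pi.sub_apply, ← map_sub, hyx, map_smul, map_sub, Pi.smul_apply, Pi.sub_apply,
          repr_eq_zero_of_mem_span hB i.2.le hl (show (i : ℕ) ≤ j from hj), sub_zero, smul_eq_mul]
      have hei : ∀ j, e (b i) j = if i = j then 1 else 0 := by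
        intro j
        have h1 : b i = B.ofZLatticeBasis ℝ Λ i := by rw [Basis.ofZLatticeBasis_apply, hB]
        rw [h1, Basis.equivFun_self]
      refine ⟨e x, ⟨x, hx, rfl⟩, e y, ⟨y, hy, rfl⟩, ?_, fun j hj => ?_⟩
      · rw [hcoord i le_rfl, hei]; simp
      · have := hcoord j hj.le
        rw [hei, if_neg hj.ne, mul_zero] at this
        linarith)
  rw [hvol, ENNReal.ofReal_le_iff_le_toReal (ENNReal.div_lt_top hfin (by
    simpa using ZLattice.covolume_pos Λ volume)).ne, ENNReal.toReal_div,
    ENNReal.toReal_ofReal (ZLattice.covolume_pos Λ volume).le] at hkey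
  rwa [Finset.prod_range]

theorem exists_one_lt_smul_mem {E : Type*} [NormedAddCommGroup E] [NormedSpace ℝ E] {U : Set E}
    (hU : IsOpen U) {w : E} (hw : w ∈ U) : ∃ t : ℝ, 1 < t ∧ t • w ∈ U := by
  have hc : ContinuousAt (fun t : ℝ => t • w) 1 := by fun_prop
  have h1 : ∀ᶠ t in nhds (1 : ℝ), t • w ∈ U := hc (hU.mem_nhds (by simpa using hw))
  obtain ⟨t, ht, ht1⟩ := ((h1.filter_mono nhdsWithin_le_nhds).and
    (self_mem_nhdsWithin : Set.Ioi (1 : ℝ) ∈ nhdsWithin 1 (Set.Ioi 1))).exists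
  exact ⟨t, ht1, ht⟩

theorem exists_upper_minima {K : Set (EuclideanSpace ℝ (Fin n))} (hK : IsConvexBody K) :
    ∃ s : ℕ → ℝ, (∀ i < n, 0 < s i) ∧ (∀ i < n, s i ∈ packingSet K Λ (n - i)) ∧
      (∏ i ∈ Finset.range n, s i) * (volume.real K / ZLattice.covolume Λ) ≤ 1 := by
  have hD := hK.isSymmetricBody_sub
  obtain ⟨b, hli, had, hQ⟩ := exists_adapted_sequence (Λ := Λ)
    (finrank_euclideanSpace_fin (𝕜 := ℝ) (n := n))
    (fun L b => ∃ s : ℝ, ∃ v : EuclideanSpace ℝ (Fin n), 0 < s ∧ v ∈ Λ ∧ v ∉ L ∧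
      v ∈ s • (K - K) ∧ b ∈ L ⊔ Submodule.span ℝ {v} ∧
      ∀ ρ : ℝ, 0 < ρ → ∀ x ∈ Λ, x ∉ L → x ∈ ρ • (K - K) → s ≤ ρ)
    (fun S hS hne => by
      obtain ⟨s, hs, ⟨v, ⟨hv, hvS⟩, hvs⟩, hmin⟩ := exists_min_dilation_lattice hD Λ
        (S := ∅) Set.finite_empty (T := {x | x ∈ Λ ∧ x ∉ Submodule.span ℝ S}) (fun x hx => hx.1)
        (fun x hx s hs => by
          have : s = 0 := by simpa using hs
          rwa [this, sub_zero])
        (fun x hx h => by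
          have : x = 0 := by simpa using h
          exact hx.2 (this ▸ zero_mem _))
        (exists_mem_lattice_notMem Λ hne)
      simp only [Submodule.span_empty, Submodule.bot_coe, Set.singleton_zero, add_zero] at hvs hmin
      -- The vector v attaining the successive minimum need not extend the lattice basis, so it is
      -- replaced by a b that does and spans the same space with S.
      obtain ⟨b, hbW, hbS, hbad, -⟩ := hS.exists_insert hD
        (W := Submodule.span ℝ S ⊔ Submodule.span ℝ {v}) le_sup_left
        ⟨v, hv, Submodule.mem_sup_right (Submodule.mem_span_singleton_self v), hvS⟩
      exact ⟨b, hbS, hbad, s, v, hs, hv, hvS, hvs, hbW, fun ρ hρ x hx hxL h =>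
        hmin ρ hρ x ⟨hx, hxL⟩ h⟩)
  have hQ' : ∀ i, ∃ s : ℝ, ∃ v : EuclideanSpace ℝ (Fin n), i < n → 0 < s ∧ v ∈ Λ ∧
      v ∉ Submodule.span ℝ (b '' Set.Iio i) ∧ v ∈ s • (K - K) ∧
      b i ∈ Submodule.span ℝ (b '' Set.Iio i) ⊔ Submodule.span ℝ {v} ∧
      ∀ ρ : ℝ, 0 < ρ → ∀ x ∈ Λ, x ∉ Submodule.span ℝ (b '' Set.Iio i) →
        x ∈ ρ • (K - K) → s ≤ ρ := by
    intro i
    by_cases hi : i < n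
    · obtain ⟨s, v, h⟩ := hQ i hi
      exact ⟨s, v, fun _ => h⟩
    · exact ⟨0, 0, fun h => (hi h).elim⟩
  choose s v hsv using hQ'
  obtain ⟨B, hB⟩ := exists_intBasis (finrank_euclideanSpace_fin (𝕜 := ℝ) (n := n)) hli had
  have hmono : ∀ i k, i ≤ k → k < n → s i ≤ s k := by
    intro i k hik hk
    refine (hsv i (by omega)).2.2.2.2.2 (s k) (hsv k hk).1 (v k) (hsv k hk).2.1 (fun h => ?_)
      (hsv k hk).2.2.2.1
    exact (hsv k hk).2.2.1
      (Submodule.span_mono (Set.image_mono (Set.Iio_subset_Iio hik)) h)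
  refine ⟨s, fun i hi => (hsv i hi).1, fun i hi => mem_packingSet (hsv i hi).1 fun L hL => ?_, ?_⟩
  -- If L contained v_0, …, v_i it would contain b_0, …, b_i, one dimension too many.
  · have hex : ∃ k ≤ i, v k ∉ L := by
      by_contra! hall
      have hle : ∀ m ≤ i + 1, Submodule.span ℝ (b '' Set.Iio m) ≤ L := by
        intro m
        induction m with
        | zero => intro _; simp
        | succ m ih =>
          intro hm
          have h0 := ih (by omega)
          refine Submodule.span_le.2 ?_
          rintro _ ⟨j, hj, rfl⟩
          rcases Nat.lt_succ_iff_lt_or_eq.1 hj with h | rfl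
          · exact h0 (Submodule.subset_span ⟨j, h, rfl⟩)
          · refine (sup_le h0 ?_) (hsv j (by omega)).2.2.2.2.1
            exact (Submodule.span_singleton_le_iff_mem _ _).2 (hall j (by omega))
      have := Submodule.finrank_mono (hle (i + 1) le_rfl)
      rw [finrank_span_image_Iio hli hi] at this
      omega
    obtain ⟨k, hk, hkL⟩ := hex
    have hkn : k < n := by omega
    exact ⟨v k, (hsv k hkn).2.1, hkL,
      hD.smul_mono (hsv k hkn).1.le (hmono k i hk hi) (hsv k hkn).2.2.2.1⟩
  set e := (B.ofZLatticeBasis ℝ Λ).equivFun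
  have hopen : IsOpen (e '' interior K) :=
    e.toContinuousLinearEquiv.isOpenMap _ isOpen_interior
  have hvol := ZLattice.volume_image_eq_volume_div_covolume' Λ B (s := interior K)
    isOpen_interior.measurableSet.nullMeasurableSet
  have hint : volume (interior K) = volume K :=
    measure_congr (interior_ae_eq_of_null_frontier (hK.convex.addHaar_frontier volume))
  have hkey := ofReal_prod_mul_volume_le_one hopen (hK.convex.interior.linear_image e.toLinearMap)
    (s := s) (fun i hi => (hsv i hi).1) (fun i hi => hmono i (i + 1) (by omega) hi)
    (fun i hi m hm j hj => by
      obtain ⟨_, ⟨_, ⟨y, hy, rfl⟩, _, ⟨x, hx, rfl⟩, rfl⟩, hmyx⟩ := hm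
      have hmyx : e (s i • (y - x)) = fun j => (m j : ℝ) := by
        rw [map_smul, map_sub]; exact hmyx
      have hmem : s i • (y - x) ∈ Λ := by
        rw [← e.symm_apply_apply (s i • (y - x)), hmyx, Basis.equivFun_symm_apply]
        refine Submodule.sum_mem _ fun j _ => ?_
        rw [Int.cast_smul_eq_zsmul, Basis.ofZLatticeBasis_apply]
        exact Λ.smul_mem _ (B j).2
      -- Openness gives room to shrink: a lattice point of s_i(int K - int K) lies in the strictly
      -- smaller dilate (s_i/t)(K - K), so by minimality of s_i it belongs to L_i.
      obtain ⟨t, ht, htU⟩ := exists_one_lt_smul_mem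
        (isOpen_interior.sub_right : IsOpen (interior K - interior K)) (w := y - x)
        ⟨y, hy, x, hx, rfl⟩
      have hspan : s i • (y - x) ∈ Submodule.span ℝ (b '' Set.Iio i) := by
        by_contra hnot
        have hsi := (hsv i hi).1
        have := (hsv i hi).2.2.2.2.2 (s i / t) (by positivity) _ hmem hnot
          ⟨t • (y - x), Set.sub_subset_sub interior_subset interior_subset htU, by
            simp only [smul_smul]
            congr 1
            field_simp⟩
        rw [le_div_iff₀ (by positivity)] at this
        nlinarith
      have := repr_eq_zero_of_mem_span hB hi.le hspan hj
      rw [show (B.ofZLatticeBasis ℝ Λ).equivFun = e from rfl, hmyx] at this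
      beta_reduce at this
      exact_mod_cast this)
  have hprod : 0 ≤ ∏ i ∈ Finset.range n, s i :=
    Finset.prod_nonneg fun i hi => (hsv i (Finset.mem_range.1 hi)).1.le
  rw [hvol, hint] at hkey
  have := ENNReal.toReal_mono ENNReal.one_ne_top hkey
  rwa [ENNReal.toReal_mul, ENNReal.toReal_ofReal hprod, ENNReal.toReal_div,
    ENNReal.toReal_ofReal (ZLattice.covolume_pos Λ volume).le, ENNReal.toReal_one] at this

theorem prod_Icc_eq_prod_range_sub (n : ℕ) (f : ℕ → ℝ) :
    ∏ i ∈ Finset.Icc 1 n, f i = ∏ i ∈ Finset.range n, f (n - i) := by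
  refine Finset.prod_nbij' (fun i => n - i) (fun i => n - i) ?_ ?_ ?_ ?_ ?_ <;>
    intro i hi <;> simp only [Finset.mem_Icc, Finset.mem_range] at hi ⊢
  · omega
  · omega
  · omega
  · omega
  · congr 1; omega

/-- Needed because `sInf ∅ = 0`: lower bounds on the members pass to `packingMin` only for a
nonempty set. -/
theorem nonempty_packingSet (Λ : Submodule ℤ (EuclideanSpace ℝ (Fin n))) [DiscreteTopology Λ]
    [IsZLattice ℝ Λ] {K : Set (EuclideanSpace ℝ (Fin n))}
    (hK : IsConvexBody K) {i : ℕ} (hi : i < n) : (packingSet K Λ (n - i)).Nonempty := by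
  obtain ⟨s, -, h, -⟩ := exists_upper_minima (Λ := Λ) hK
  exact ⟨_, h i hi⟩

theorem packingMin_pos (Λ : Submodule ℤ (EuclideanSpace ℝ (Fin n))) [DiscreteTopology Λ]
    [IsZLattice ℝ Λ] {K : Set (EuclideanSpace ℝ (Fin n))}
    (hK : IsConvexBody K) {i : ℕ} (hi : i < n) : 0 < packingMin K Λ (n - i) := by
  obtain ⟨μ, h0, h, -⟩ := exists_lower_minima (Λ := Λ) hK
  exact (h0 i hi).trans_le (le_csInf (nonempty_packingSet Λ hK hi) (h i hi))

theorem prod_packingMin_le_volume (Λ : Submodule ℤ (EuclideanSpace ℝ (Fin n)))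
    [DiscreteTopology Λ] [IsZLattice ℝ Λ] {K : Set (EuclideanSpace ℝ (Fin n))}
    (hK : IsConvexBody K) :
    1 / (n ! : ℝ) * ∏ i ∈ Finset.Icc 1 n, 1 / packingMin K Λ i ≤
      volume.real K / ZLattice.covolume Λ := by
  obtain ⟨μ, h0, h, hvol⟩ := exists_lower_minima (Λ := Λ) hK
  refine le_trans ?_ hvol
  rw [prod_Icc_eq_prod_range_sub, one_div_mul_eq_div]
  refine div_le_div_of_nonneg_right (Finset.prod_le_prod (fun i hi => ?_) fun i hi => ?_)
    (by positivity)
  · exact one_div_nonneg.2 (packingMin_pos Λ hK (Finset.mem_range.1 hi)).le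
  · have hi := Finset.mem_range.1 hi
    exact one_div_le_one_div_of_le (h0 i hi) (le_csInf (nonempty_packingSet Λ hK hi) (h i hi))

theorem volume_le_prod_packingMin (Λ : Submodule ℤ (EuclideanSpace ℝ (Fin n)))
    [DiscreteTopology Λ] [IsZLattice ℝ Λ] {K : Set (EuclideanSpace ℝ (Fin n))}
    (hK : IsConvexBody K) :
    volume.real K / ZLattice.covolume Λ ≤ ∏ i ∈ Finset.Icc 1 n, 1 / packingMin K Λ i := by
  obtain ⟨s, h0, h, hvol⟩ := exists_upper_minima (Λ := Λ) hK
  have hpos : 0 < ∏ i ∈ Finset.range n, s i :=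
    Finset.prod_pos fun i hi => h0 i (Finset.mem_range.1 hi)
  rw [mul_comm, ← le_div_iff₀ hpos] at hvol
  refine hvol.trans ?_
  rw [prod_Icc_eq_prod_range_sub, one_div, ← Finset.prod_inv_distrib]
  refine Finset.prod_le_prod (fun i hi => ?_) fun i hi => ?_
  · exact inv_nonneg.2 (h0 i (Finset.mem_range.1 hi)).le
  · have hi := Finset.mem_range.1 hi
    rw [← one_div]
    exact one_div_le_one_div_of_le (packingMin_pos Λ hK hi) (packingMin_le (h i hi))

end Bounds

/-! ### Sharpness: boxes and their polars -/

theorem stdLattice_eq (n : ℕ) : stdLattice n =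
    Submodule.span ℤ (Set.range (EuclideanSpace.basisFun (Fin n) ℝ).toBasis) := by
  rw [stdLattice, OrthonormalBasis.coe_toBasis]

instance discreteTopology_stdLattice (n : ℕ) : DiscreteTopology (stdLattice n) := by
  rw [stdLattice_eq]; infer_instance

instance isZLattice_stdLattice (n : ℕ) : IsZLattice ℝ (stdLattice n) where
  span_top := by
    rw [stdLattice_eq, Submodule.span_span_of_tower, Basis.span_eq]

theorem covolume_stdLattice (n : ℕ) : ZLattice.covolume (stdLattice n) = 1 := by
  rw [stdLattice_eq, ZLattice.covolume_eq_measure_fundamentalDomain _ _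
    (ZSpan.isAddFundamentalDomain _ _), Measure.real,
    measure_congr (ZSpan.fundamentalDomain_ae_parallelepiped _ _), OrthonormalBasis.coe_toBasis,
    OrthonormalBasis.volume_parallelepiped, ENNReal.toReal_one]

theorem mem_stdLattice {n : ℕ} {x : EuclideanSpace ℝ (Fin n)} :
    x ∈ stdLattice n ↔ ∀ j, ∃ m : ℤ, (m : ℝ) = x j := by
  rw [stdLattice_eq, Basis.mem_span_iff_repr_mem]
  simp

theorem single_mem_stdLattice {n : ℕ} (k : Fin n) :
    EuclideanSpace.single k (1 : ℝ) ∈ stdLattice n :=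
  Submodule.subset_span ⟨k, by simp⟩

theorem linearIndependent_single (n : ℕ) :
    LinearIndependent ℝ (fun k : Fin n => EuclideanSpace.single k (1 : ℝ)) := by
  have h : (fun k : Fin n => EuclideanSpace.single k (1 : ℝ)) =
      (EuclideanSpace.basisFun (Fin n) ℝ).toBasis := by
    ext k; simp
  rw [h]
  exact Basis.linearIndependent _

theorem box_eq_preimage {n : ℕ} (r : Fin n → ℝ) :
    box r = EuclideanSpace.equiv (Fin n) ℝ ⁻¹' (Set.univ.pi fun j => Set.Icc (-r j) (r j)) := by
  ext x; simp [box, -Set.pi_univ_Icc]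

theorem isConvexBody_box {n : ℕ} {r : Fin n → ℝ} (hr : ∀ j, 0 < r j) : IsConvexBody (box r) where
  convex := by
    rw [box_eq_preimage]
    exact (convex_pi fun j _ => convex_Icc _ _).linear_preimage
      (EuclideanSpace.equiv (Fin n) ℝ).toLinearMap
  isCompact := by
    rw [box_eq_preimage]
    exact (EuclideanSpace.equiv (Fin n) ℝ).toHomeomorph.isCompact_preimage.2
      (isCompact_univ_pi fun j => isCompact_Icc)
  nonempty_interior := by
    refine ⟨0, mem_interior.2 ⟨EuclideanSpace.equiv (Fin n) ℝ ⁻¹'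
      (Set.univ.pi fun j => Set.Ioo (-r j) (r j)), ?_, ?_, ?_⟩⟩
    · rw [box_eq_preimage]
      exact Set.preimage_mono (Set.pi_mono fun j _ => Set.Ioo_subset_Icc_self)
    · exact (isOpen_set_pi Set.finite_univ fun j _ => isOpen_Ioo).preimage
        (EuclideanSpace.equiv (Fin n) ℝ).continuous
    · simp [hr]

theorem volume_preimage_equiv {n : ℕ} (S : Set (Fin n → ℝ)) :
    volume (EuclideanSpace.equiv (Fin n) ℝ ⁻¹' S) = volume S :=
  (EuclideanSpace.volume_preserving_symm_measurableEquiv_toLp (Fin n)).measure_preimage_equiv S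

theorem volume_box {n : ℕ} {r : Fin n → ℝ} (hr : ∀ j, 0 < r j) :
    volume.real (box r) = ∏ j, 2 * r j := by
  rw [Measure.real, box_eq_preimage, volume_preimage_equiv, Set.pi_univ_Icc,
    Real.volume_Icc_pi_toReal]
  · exact Finset.prod_congr rfl fun j _ => by ring
  · intro j; linarith [hr j]

/-- Take L spanned by the i unit vectors of largest index. An integer point outside L has a nonzero
coordinate j ≤ `i.rev`, of absolute value at least 1, while on ρ(K - K) + L that coordinate is at
most 2ρ r_j ≤ 2ρ r_{i.rev}. -/
theorem inv_le_packingMin_box {n : ℕ} {r : Fin n → ℝ} (hr : ∀ j, 0 < r j) (hmono : Monotone r)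
    (i : Fin n) : 1 / (2 * r i.rev) ≤ packingMin (box r) (stdLattice n) (n - i) := by
  have hK := isConvexBody_box hr
  set e := (EuclideanSpace.basisFun (Fin n) ℝ).toBasis
  set L := Submodule.span ℝ (e '' {j | i.rev < j}) with hL
  refine le_csInf (nonempty_packingSet _ hK i.2) fun ρ hρ => ?_
  refine le_of_mem_packingSet hK (L := L) ?_ ?_ hρ
  · have h := finrank_span_eq_card
      (e.linearIndependent.comp (Subtype.val : {j // i.rev < j} → Fin n) Subtype.val_injective)
    rw [Set.range_comp, Subtype.range_coe_subtype, ← hL] at h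
    have hcard : Fintype.card {j // i.rev < j} = i := by
      rw [Fintype.card_subtype]
      have : Finset.univ.filter (fun j => i.rev < j) = Finset.Ioi i.rev := by ext; simp
      rw [this, Fin.card_Ioi, Fin.val_rev]
      omega
    rw [h, hcard]
    omega
  · intro ρ hρ x hx hxL hxK
    by_contra hlt
    rw [not_le] at hlt
    refine hxL ?_
    rw [hL, Basis.mem_span_image]
    intro j hj
    by_contra hji
    have hji : j ≤ i.rev := not_lt.1 hji
    have hxj : x j ≠ 0 := by simpa [e] using hj
    obtain ⟨_, ⟨_, ⟨y, hy, z, hz, rfl⟩, rfl⟩, l, hl, rfl⟩ := hxK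
    have hlj : l j = 0 := by
      by_contra hne
      rw [hL, SetLike.mem_coe, Basis.mem_span_image] at hl
      have hmem : j ∈ {j | i.rev < j} := hl (by simpa [e] using hne)
      exact absurd hmem (not_lt.2 hji)
    obtain ⟨m, hm⟩ := mem_stdLattice.1 hx j
    simp only [PiLp.add_apply, PiLp.smul_apply, PiLp.sub_apply, hlj, add_zero, smul_eq_mul]
      at hm hxj
    have hm0 : m ≠ 0 := by rintro rfl; simp at hm; simp_all
    have h1 : (1 : ℝ) ≤ |(m : ℝ)| := by exact_mod_cast Int.one_le_abs hm0
    rw [hm, abs_mul, abs_of_pos hρ] at h1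
    have h2 : |y j - z j| ≤ 2 * r i.rev := by
      have := hmono hji
      rw [abs_le]
      constructor <;> linarith [(hy j).1, (hy j).2, (hz j).1, (hz j).2]
    have h3 : ρ * (2 * r i.rev) < 1 := (lt_div_iff₀ (by have := hr i.rev; positivity)).1 hlt
    linarith [mul_le_mul_of_nonneg_left h2 hρ.le]

theorem mem_polarBody_box {n : ℕ} {r : Fin n → ℝ} (hr : ∀ j, 0 < r j)
    {y : EuclideanSpace ℝ (Fin n)} : y ∈ polarBody (box r) ↔ ∑ j, r j * |y j| ≤ 1 := by
  have hinner : ∀ x : EuclideanSpace ℝ (Fin n), inner ℝ x y = ∑ j, x j * y j := by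
    intro x; simp [PiLp.inner_apply, mul_comm]
  constructor
  · intro h
    -- The point of the box maximising the inner product with y.
    have := h (WithLp.toLp 2 fun j => r j * SignType.sign (y j)) (fun j => by
      have := (hr j).le
      rcases lt_trichotomy (y j) 0 with h | h | h <;> simp [h] <;> linarith)
    rw [hinner] at this
    convert this using 2 with j
    simp [mul_assoc]
  · intro h x hx
    rw [hinner]
    refine le_trans (Finset.sum_le_sum fun j _ => ?_) h
    refine (le_abs_self _).trans ?_
    rw [abs_mul]
    exact mul_le_mul_of_nonneg_right (abs_le.2 (hx j)) (abs_nonneg _)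

theorem isConvexBody_polarBody_box {n : ℕ} {r : Fin n → ℝ} (hr : ∀ j, 0 < r j) :
    IsConvexBody (polarBody (box r)) where
  convex := by
    intro x hx y hy a b ha hb hab z hz
    rw [inner_add_right, inner_smul_right, inner_smul_right]
    nlinarith [mul_le_mul_of_nonneg_left (hx z hz) ha, mul_le_mul_of_nonneg_left (hy z hz) hb]
  isCompact := by
    refine (isConvexBody_box (r := fun j => (r j)⁻¹) fun j => inv_pos.2 (hr j)).isCompact
      |>.of_isClosed_subset ?_ ?_
    · have : polarBody (box r) = ⋂ x ∈ box r, {y | inner ℝ x y ≤ 1} := by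
        ext; simp [polarBody]
      rw [this]
      exact isClosed_biInter fun x _ => isClosed_le (by fun_prop) continuous_const
    · intro y hy j
      rw [mem_polarBody_box hr] at hy
      have h1 : r j * |y j| ≤ 1 := (Finset.single_le_sum (f := fun j => r j * |y j|)
        (fun k _ => mul_nonneg (hr k).le (abs_nonneg _)) (Finset.mem_univ j)).trans hy
      exact abs_le.1 ((le_inv_mul_iff₀ (hr j)).2 h1 |>.trans_eq (mul_one _))
  nonempty_interior := by
    refine ⟨0, mem_interior.2 ⟨{y | ∑ j, r j * |y j| < 1}, fun y hy => ?_, ?_, ?_⟩⟩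
    · exact (mem_polarBody_box hr).2 (le_of_lt hy)
    · exact isOpen_lt (by fun_prop) continuous_const
    · simp

theorem volume_sum_mul_abs_le_one {n : ℕ} {r : Fin n → ℝ} (hr : ∀ j, 0 < r j) :
    volume {y : Fin n → ℝ | ∑ j, r j * |y j| ≤ 1} =
      ENNReal.ofReal (1 / n ! * ∏ j, 2 / r j) := by
  rcases n with _ | n
  · simp [volume_pi]
  have hdet : LinearMap.det (Matrix.toLin' (Matrix.diagonal r)) = ∏ j, r j := by
    rw [LinearMap.det_toLin', Matrix.det_diagonal]
  have hpos : 0 < ∏ j, r j := Finset.prod_pos fun j _ => hr j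
  have hset : {y : Fin (n + 1) → ℝ | ∑ j, r j * |y j| ≤ 1} =
      Matrix.toLin' (Matrix.diagonal r) ⁻¹'
        {y | (∑ j, |y j| ^ (1 : ℝ)) ^ (1 / (1 : ℝ)) ≤ 1} := by
    ext y
    simp [Matrix.mulVec_diagonal, abs_mul, abs_of_pos (hr _)]
  rw [hset, Measure.addHaar_preimage_linearMap _ (by rw [hdet]; exact hpos.ne'),
    volume_sum_rpow_le (ι := Fin (n + 1)) (p := 1) le_rfl 1, hdet, abs_of_pos (inv_pos.2 hpos), ENNReal.ofReal_one, one_pow,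
    one_mul, ← ENNReal.ofReal_mul (inv_pos.2 hpos).le]
  congr 1
  rw [Fintype.card_fin, div_one, div_one, Real.Gamma_nat_eq_factorial, show (1 : ℝ) + 1 = 2 by ring,
    Real.Gamma_two, Finset.prod_div_distrib, Finset.prod_const, Finset.card_univ, Fintype.card_fin]
  field_simp

/-- A subspace of dimension i misses one of the first i + 1 unit vectors. That vector, with index k
≤ i, is r_i/2 times the difference of ±e_k/r_i, and these lie in the polar because r_k ≤ r_i. -/
theorem packingMin_polarBody_box_le {n : ℕ} {r : Fin n → ℝ} (hr : ∀ j, 0 < r j)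
    (hmono : Monotone r) (i : Fin n) :
    packingMin (polarBody (box r)) (stdLattice n) (n - i) ≤ r i / 2 := by
  have hri := hr i
  refine packingMin_le (mem_packingSet (by positivity) fun L hL => ?_)
  have hex : ∃ k ≤ i, EuclideanSpace.single k (1 : ℝ) ∉ L := by
    by_contra! hall
    have h := finrank_span_eq_card
      ((linearIndependent_single n).comp (Subtype.val : {j // j ≤ i} → Fin n)
        Subtype.val_injective)
    have hcard : Fintype.card {j // j ≤ i} = i + 1 := by
      rw [Fintype.card_subtype]
      have : Finset.univ.filter (fun j => j ≤ i) = Finset.Iic i := by ext; simp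
      rw [this, Fin.card_Iic]
    have hle := Submodule.finrank_mono (Submodule.span_le.2
      (Set.range_subset_iff.2 fun k : {j // j ≤ i} => hall k k.2))
    have hle : finrank ℝ (Submodule.span ℝ (Set.range
      ((fun k : Fin n => EuclideanSpace.single k (1 : ℝ)) ∘
        (Subtype.val : {j // j ≤ i} → Fin n)))) ≤ finrank ℝ L := hle
    rw [h, hcard] at hle
    have := i.2
    omega
  obtain ⟨k, hk, hkL⟩ := hex
  have hmem : ∀ c : ℝ, |c| = 1 / r i →
      c • EuclideanSpace.single k (1 : ℝ) ∈ polarBody (box r) := by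
    intro c hc
    rw [mem_polarBody_box hr, Finset.sum_eq_single k]
    · simp only [PiLp.smul_apply, PiLp.single_apply, if_true, smul_eq_mul, mul_one, hc]
      rw [mul_one_div]
      exact (div_le_one hri).2 (hmono hk)
    · intro j _ hj; simp [hj]
    · simp
  refine ⟨_, single_mem_stdLattice k, hkL, _,
    ⟨(1 / r i) • EuclideanSpace.single k (1 : ℝ), hmem _ (abs_of_pos (by positivity)),
      (-(1 / r i)) • EuclideanSpace.single k (1 : ℝ), hmem _ ?_, rfl⟩, ?_⟩
  · rw [abs_neg, abs_of_pos (by positivity)]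
  · simp only [← sub_smul, smul_smul]
    rw [show r i / 2 * (1 / r i - -(1 / r i)) = 1 by field_simp; ring, one_smul]


theorem theorem1p2 (n : ℕ) :
    -- the two inequalities
    (∀ (K : Set (EuclideanSpace ℝ (Fin n))) (Λ : Submodule ℤ (EuclideanSpace ℝ (Fin n)))
        [DiscreteTopology Λ] [IsZLattice ℝ Λ], IsConvexBody K →
      1 / (n ! : ℝ) * ∏ i ∈ Finset.Icc 1 n, 1 / packingMin K Λ i
          ≤ volume.real K / ZLattice.covolume Λ ∧
        volume.real K / ZLattice.covolume Λ
          ≤ ∏ i ∈ Finset.Icc 1 n, 1 / packingMin K Λ i) ∧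
    -- both are sharp: equality on the right for boxes, on the left for their polars
    (∀ r : Fin n → ℝ, (∀ j, 0 < r j) → Monotone r →
      (IsConvexBody (box r) ∧
        volume.real (box r) / ZLattice.covolume (stdLattice n)
          = ∏ i ∈ Finset.Icc 1 n, 1 / packingMin (box r) (stdLattice n) i) ∧
      (IsConvexBody (polarBody (box r)) ∧
        1 / (n ! : ℝ) * ∏ i ∈ Finset.Icc 1 n, 1 / packingMin (polarBody (box r)) (stdLattice n) i
          = volume.real (polarBody (box r)) / ZLattice.covolume (stdLattice n))) := by
  refine ⟨fun K Λ _ _ hK => ⟨prod_packingMin_le_volume Λ hK, volume_le_prod_packingMin Λ hK⟩,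
    fun r hr hmono => ?_⟩
  have hbox := isConvexBody_box hr
  have hpolar := isConvexBody_polarBody_box hr
  -- The general theorem supplies one inequality in each equality; only bounds on the individual
  -- minima remain.
  refine ⟨⟨hbox, le_antisymm (volume_le_prod_packingMin _ hbox) ?_⟩,
    ⟨hpolar, le_antisymm (prod_packingMin_le_volume _ hpolar) ?_⟩⟩
  -- The order is reversed because ρ_{n-i} of the box is compared with 1/(2 r_{i.rev}).
  · rw [covolume_stdLattice, div_one, volume_box hr, prod_Icc_eq_prod_range_sub,
      Finset.prod_range, ← Equiv.prod_comp Fin.revPerm (fun j => 2 * r j)]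
    refine Finset.prod_le_prod
      (fun i _ => one_div_nonneg.2 (packingMin_pos _ hbox i.2).le) fun i _ => ?_
    have hri := hr i.rev
    exact (one_div_le (packingMin_pos _ hbox i.2) (mul_pos two_pos hri)).2
      (inv_le_packingMin_box hr hmono i)
  · have hset : polarBody (box r) =
        EuclideanSpace.equiv (Fin n) ℝ ⁻¹' {y | ∑ j, r j * |y j| ≤ 1} := by
      ext y; rw [mem_polarBody_box hr]; rfl
    have hvol : volume.real (polarBody (box r)) = 1 / n ! * ∏ j, 2 / r j := by
      rw [Measure.real, hset, volume_preimage_equiv, volume_sum_mul_abs_le_one hr,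
        ENNReal.toReal_ofReal]
      exact mul_nonneg (by positivity)
        (Finset.prod_nonneg fun j _ => div_nonneg zero_le_two (hr j).le)
    rw [covolume_stdLattice, div_one, hvol, prod_Icc_eq_prod_range_sub, Finset.prod_range]
    refine mul_le_mul_of_nonneg_left (Finset.prod_le_prod
      (fun j _ => div_nonneg zero_le_two (hr j).le) fun i _ => ?_) (by positivity)
    rw [← one_div_div]
    exact one_div_le_one_div_of_le (packingMin_pos _ hpolar i.2)
      (packingMin_polarBody_box_le hr hmono i)
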